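/- **Setting.** Let $2s\in\mathbb Z_{\ge 0}$ and let $q\in\mathbb C^*$ be not a root of unity. Put $b(x)=x-x^{-1}$ and $[X,Y]_t=tXY-t^{-1}YX$. Let $\mathtt b,\mathtt c,\mathtt b^*,\mathtt c^*,\mathtt b^\diamond,\mathtt c^\diamond,r_0,\zeta\in\mathbb C^*$ satisfy $$r_0^{-2}=\mathtt b\mathtt c=\mathtt b^*\mathtt c^*=\mathtt b^\diamond\mathtt c^\diamond,\qquad \zeta^{-2}=\mathtt b^\diamond r_0q^{2s},\qquad \zeta^2=\mathtt c^\diamond r_0q^{-2s}.$$ For $a\in\{\cdot,*,\diamond\}$ put $\theta^a_M=\mathtt b^aq^{2M}+\mathtt c^aq^{-2M}$ ($M=s$ allowed) and $$\omega^{\{a,b,c\}}=-(q-q^{-1})^2\Big(\theta^a_s\theta^b_s-r_0^{-1}(q^{2s+1}+q^{-2s-1})\theta^c_s\Big),\qquad \rho=-\frac{(q^2-q^{-2})^2}{r_0^2},\qquad \omega=\omega^{\{\cdot,*,\diamond\}},$$ $$\eta=\frac{q+q^{-1}}{r_0}\,\omega^{\{\cdot,\diamond,*\}},\qquad \eta^*=\frac{q+q^{-1}}{r_0}\,\omega^{\{*,\diamond,\cdot\}}.$$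 The Askey–Wilson algebra $\mathrm{AW}$ is the $\mathbb C$-algebra generated by $\mathsf A,\mathsf A^*$ with relations $[\mathsf A,[\mathsf A,\mathsf A^*]_q]_{q^{-1}}=\rho\mathsf A^*+\omega\mathsf A+\eta$ and $[\mathsf A^*,[\mathsf A^*,\mathsf A]_q]_{q^{-1}}=\rho\mathsf A+\omega\mathsf A^*+\eta^*$. Let $\pi:\mathrm{AW}\to\mathrm{End}(\mathcal V)$ be a representation with $\dim\mathcal V=2s+1$ such that $A=\pi(\mathsf A)$, $A^*=\pi(\mathsf A^*)$ form a Leonard pair with eigenvalue sequences $(\theta_M)_{M=0}^{2s}$, $(\theta^*_N)_{N=0}^{2s}$, each consisting of distinct numbers. That is, there are a basis $|\theta_M\rangle$ of eigenvectors, $A|\theta_M\rangle=\theta_M|\theta_M\rangle$, in which $A^*$ is irreducible tridiagonal, and a basis $|\theta^*_N\rangle$ with $A^*|\theta^*_N\rangle=\theta^*_N|\theta^*_N\rangle$ in which $A$ is irreducible tridiagonal. Let $\langle\theta_M|$ be a nonzero linear functional on $\mathcal V$ with $\langle\theta_M|A=\theta_M\langle\theta_M|$. **Bethe states.** Let $\epsilon=\pm1$,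 $m\in\mathbb Z$, $\chi\in\mathbb C^*$, and let $\alpha$ satisfy $(q^2-q^{-2})\chi^{-1}\alpha\,\mathtt c^*q^{m}=1$ if $\epsilon=+$, and $(q^2-q^{-2})\chi^{-1}\alpha\,\mathtt b\,q^{-m}=-1$ if $\epsilon=-$. The dynamical operators (with gauge parameter $\beta=0$) are, for $n\in\mathbb Z$, $$\mathscr B^+(u,n)=\frac{b(u^2)}{\alpha q^{2n+2}}\Big(\frac{\chi q^{n}}{\rho u}[\mathsf A^*,\mathsf A]_q+\frac{\chi q^{n-1}}{\rho\, b(q^2)}\big((q^2+1)u^{-1}\omega+\rho(q^2u+u^{-3})\big)\Big),$$ $$\mathscr B^-(u,n)=\frac{b(u^2)q^{2n+3}}{\alpha}\Big(\frac{u\chi q^{-n-1}}{\rho}[\mathsf A^*,\mathsf A]_q+\frac{\chi q^{-n-2}}{\rho\, b(q^2)}\big((q^2+1)u\,\omega+\rho(q^2u^3+u^{-1})\big)\Big).$$ With $|\Omega^+\rangle=|\theta^*_0\rangle$, $|\Omega^-\rangle=|\theta_0\rangle$ and $\bar u=\{u_1,\dots,u_{2s}\}$, the off-shell Bethe state is $$|\Psi^{2s}_\epsilon(\bar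 u,m)\rangle=\pi\big(\mathscr B^\epsilon(u_1,m+2(2s-1))\cdots\mathscr B^\epsilon(u_{2s},m)\big)|\Omega^\epsilon\rangle .$$ **Coefficients.** Put $$\Lambda_1^\epsilon(u)=\tfrac{q^{-2s-1}}{u^\epsilon}\big(q^{2s+1}u\zeta^{-1}-u^{-1}\zeta\big)\big(q^{2s+1}u\zeta-u^{-1}\zeta^{-1}\big)\big(u\mathtt c^*q^{-2s}+u^{-1}\mathtt bq^{2s}\big)\Big(u\big(\tfrac{\mathtt c}{\mathtt c^*}\big)^{\frac{1-\epsilon}2}+u^{-1}\big(\tfrac{\mathtt b^*}{\mathtt b}\big)^{\frac{1+\epsilon}2}\Big),$$ $$\Lambda_2^\epsilon(u)=\tfrac{(u^2-u^{-2})q^{-2s-1}}{u^\epsilon(qu^2-q^{-1}u^{-2})}\big(q^{2s-1}u^{-1}\zeta-u\zeta^{-1}\big)\big(q^{2s-1}u^{-1}\zeta^{-1}-u\zeta\big)\big(q^2u\mathtt bq^{2s}+u^{-1}\mathtt c^*q^{-2s}\big)\Big(q^2u\big(\tfrac{\mathtt b^*}{\mathtt b}\big)^{\frac{1+\epsilon}2}+u^{-1}\big(\tfrac{\mathtt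 c}{\mathtt c^*}\big)^{\frac{1-\epsilon}2}\Big),$$ $\nu_+=q^{-1-4s}\mathtt c^*$, $g(u,\bar u)=\prod_{u_i\in\bar u}\big(b(u/u_i)b(quu_i)\big)^{-1}$, and $$Y_\epsilon(u|\bar u)=\frac{u^{2\epsilon+1}\Lambda^\epsilon_1(u)}{b(u^2)b(qu^2)}\prod_{u_i\in\bar u}b\big(\tfrac{u}{qu_i}\big)b(uu_i)+\frac{q^{-\epsilon-1}u^{-1}\Lambda^\epsilon_2(u)}{b(u^2)b(q^2u^2)}\prod_{u_i\in\bar u}b\big(\tfrac{qu}{u_i}\big)b(q^2uu_i)-\delta_{\epsilon,+}\nu_+\prod_{j=0}^{2s}b(q^{\frac12+j-s}u\zeta)b(q^{\frac12+j-s}u\zeta^{-1}).$$ For $\bar{\mathcal Y}=\{y_1,\dots,y_{2s+1}\}\subset\mathbb C$ put $\bar{\mathcal Y}_k=\bar{\mathcal Y}\setminus y_k$ and $$L^\epsilon_{jk}=\Big(\frac{y_j}{y_k}\Big)^{\epsilon}\frac{b(y_k^2)}{b(y_j^2)}\,g(y_k,\bar{\mathcal Y}_k)\,Y_\epsilon(y_k|\bar{\mathcal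 Y}_j)+\delta_{jk}\frac{(q+q^{-1})^2}{\rho\, b(y_j^2)b(q^2y_j^2)}\Big(\eta^*+\eta\,\frac{qy_j^2+q^{-1}y_j^{-2}}{q+q^{-1}}\Big).$$ **Proposition.** Let $y_1,\dots,y_{2s+1}$ be distinct complex numbers, arbitrary except that no denominator above vanishes: $y_j\neq0$ and $b(y_j^2),b(qy_j^2),b(q^2y_j^2)\ne0$ for all $j$, and $b(y_j/y_k),b(qy_jy_k)\neq0$ for $j\ne k$. Then the $L^\epsilon_{jk}$ describe the off-shell action of $A$, $$A|\Psi^{2s}_\epsilon(\bar{\mathcal Y}_j,m)\rangle=\sum_{k=1}^{2s+1}L^\epsilon_{jk}|\Psi^{2s}_\epsilon(\bar{\mathcal Y}_k,m)\rangle,\qquad j=1,\dots,2s+1,$$ and for every $M=0,1,\dots,2s$ one has $\langle\theta_M|\theta_M\rangle\ne0$, and the normalized scalar product $$X^{\epsilon,\mathrm{off}}_M(\bar u)=\frac{\langle\theta_M|\Psi^{2s}_\epsilon(\bar u,m)\rangle}{\langle\theta_M|\theta_M\rangle}$$ solves the Belliard–Slavnov homogeneous linear system $$\sum_{k=1}^{2s+1}\big(L^\epsilon_{jk}-\delta_{jk}\theta_M\big)X^{\epsilon,\mathrm{off}}_M(\bar{\mathcal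 Y}_k)=0,\qquad j=1,\dots,2s+1.$$ -/

import Mathlib

noncomputable section

namespace LeonardBethe

/-- The function `b(x) = x - x⁻¹`. -/
def bfun (x : ℂ) : ℂ := x - x⁻¹

/-- The `t`-commutator `[X, Y]_t = t X Y - t⁻¹ Y X`. -/
def tComm {R : Type*} [Ring R] [Algebra ℂ R] (t : ℂ) (X Y : R) : R :=
  t • (X * Y) - t⁻¹ • (Y * X)

/-- The sign `ε = ±`. -/
inductive Eps
  | plus
  | minus

/-- `ε` as the integer `±1`. -/
def Eps.toInt : Eps → ℤ
  | .plus => 1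
  | .minus => -1

/-! ### The Askey-Wilson algebra -/

/-- The two generators of the Askey-Wilson algebra. -/
inductive AWGen
  | A
  | As

/-- The defining relations of the Askey-Wilson algebra. -/
inductive AWRel (q ρ ω η ηs : ℂ) : FreeAlgebra ℂ AWGen → FreeAlgebra ℂ AWGen → Prop
  | rel :
      AWRel q ρ ω η ηs
        (tComm q⁻¹ (FreeAlgebra.ι ℂ AWGen.A)
          (tComm q (FreeAlgebra.ι ℂ AWGen.A) (FreeAlgebra.ι ℂ AWGen.As)))
        (ρ • FreeAlgebra.ι ℂ AWGen.As + ω • FreeAlgebra.ι ℂ AWGen.A + η • 1)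
  | relStar :
      AWRel q ρ ω η ηs
        (tComm q⁻¹ (FreeAlgebra.ι ℂ AWGen.As)
          (tComm q (FreeAlgebra.ι ℂ AWGen.As) (FreeAlgebra.ι ℂ AWGen.A)))
        (ρ • FreeAlgebra.ι ℂ AWGen.A + ω • FreeAlgebra.ι ℂ AWGen.As + ηs • 1)

/-- The Askey-Wilson algebra with structure constants `ρ, ω, η, η*`. -/
abbrev AWAlgebra (q ρ ω η ηs : ℂ) : Type := RingQuot (AWRel q ρ ω η ηs)

/-! ### Parameters of `q`-Racah type -/

/-- Scalars attached to a Leonard triple of `q`-Racah type: `d = 2s`, the deformation parameter `q`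
(not a root of unity), a square root of `q` (it only serves to write `q ^ (1/2 + j - s)`),
the pairs `(b, c)`, `(b*, c*)`, `(b⋄, c⋄)`, the scalar `r₀` with
`r₀⁻² = b c = b* c* = b⋄ c⋄`, and `ζ` with `ζ⁻² = b⋄ r₀ q^{2s}`, `ζ² = c⋄ r₀ q^{-2s}`. -/
structure QRacahParams where
  /-- `d = 2s` -/
  d : ℕ
  q : ℂ
  sqrtq : ℂ
  b : ℂ
  c : ℂ
  bs : ℂ
  cs : ℂ
  bd : ℂ
  cd : ℂ
  r0 : ℂ
  ζ : ℂ
  q_ne_zero : q ≠ 0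
  q_not_root_of_unity : ∀ n : ℕ, 0 < n → q ^ n ≠ 1
  sqrtq_sq : sqrtq ^ 2 = q
  r0_ne_zero : r0 ≠ 0
  bc_eq : b * c = (r0 ^ 2)⁻¹
  bcs_eq : bs * cs = (r0 ^ 2)⁻¹
  bcd_eq : bd * cd = (r0 ^ 2)⁻¹
  zeta_ne_zero : ζ ≠ 0
  zeta_inv_sq : (ζ ^ 2)⁻¹ = bd * r0 * q ^ d
  zeta_sq : ζ ^ 2 = cd * r0 * (q ^ d)⁻¹

namespace QRacahParams

variable (P : QRacahParams)

/-- `θ_M = b q^{2M} + c q^{-2M}`. -/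
def θ (M : ℕ) : ℂ := P.b * P.q ^ (2 * (M : ℤ)) + P.c * P.q ^ (-2 * (M : ℤ))

/-- `θ*_N = b* q^{2N} + c* q^{-2N}`. -/
def θs (N : ℕ) : ℂ := P.bs * P.q ^ (2 * (N : ℤ)) + P.cs * P.q ^ (-2 * (N : ℤ))

/-- `θ_s = b q^{2s} + c q^{-2s}`. -/
def θmid : ℂ := P.b * P.q ^ (P.d : ℤ) + P.c * P.q ^ (-(P.d : ℤ))

/-- `θ*_s = b* q^{2s} + c* q^{-2s}`. -/
def θsMid : ℂ := P.bs * P.q ^ (P.d : ℤ) + P.cs * P.q ^ (-(P.d : ℤ))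

/-- `θ⋄_s = b⋄ q^{2s} + c⋄ q^{-2s}`. -/
def θdMid : ℂ := P.bd * P.q ^ (P.d : ℤ) + P.cd * P.q ^ (-(P.d : ℤ))

/-- `-(q - q⁻¹)² (x y - r₀⁻¹ (q^{2s+1} + q^{-2s-1}) z)`; at `x = θ^a_s`, `y = θ^b_s`, `z = θ^c_s`
this is `ω^{a,b,c}`. -/
def omegaOf (x y z : ℂ) : ℂ :=
  -(P.q - P.q⁻¹) ^ 2 *
    (x * y - P.r0⁻¹ * (P.q ^ ((P.d : ℤ) + 1) + P.q ^ (-(P.d : ℤ) - 1)) * z)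

/-- `ρ = -(q² - q⁻²)² / r₀²`. -/
def ρ : ℂ := -(P.q ^ 2 - (P.q ^ 2)⁻¹) ^ 2 / P.r0 ^ 2

/-- `ω = ω^{.,*,⋄}`. -/
def ω : ℂ := P.omegaOf P.θmid P.θsMid P.θdMid

/-- `η = (q + q⁻¹) r₀⁻¹ ω^{.,⋄,*}`. -/
def η : ℂ := (P.q + P.q⁻¹) / P.r0 * P.omegaOf P.θmid P.θdMid P.θsMid

/-- `η* = (q + q⁻¹) r₀⁻¹ ω^{*,⋄,.}`. -/
def ηs : ℂ := (P.q + P.q⁻¹) / P.r0 * P.omegaOf P.θsMid P.θdMid P.θmid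

/-- The Askey-Wilson algebra with the structure constants above. -/
abbrev AW : Type := AWAlgebra P.q P.ρ P.ω P.η P.ηs

/-- The generator `A` of the Askey-Wilson algebra. -/
def genA : P.AW := RingQuot.mkAlgHom ℂ _ (FreeAlgebra.ι ℂ AWGen.A)

/-- The generator `A*` of the Askey-Wilson algebra. -/
def genAs : P.AW := RingQuot.mkAlgHom ℂ _ (FreeAlgebra.ι ℂ AWGen.As)

/-! ### Dynamical operators -/

/-- The dynamical operator `𝓑^ε(u, m)` with gauge parameters `α, β, χ`, an element of the
Askey-Wilson algebra. The overall factor `β` is multiplied into the bracket, where it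
cancels the factors `β⁻¹`, so that the expression also makes sense at `β = 0`. -/
def dynB (α β χ : ℂ) (ε : Eps) (u : ℂ) (m : ℤ) : P.AW :=
  match ε with
  | .plus =>
    (bfun (u ^ 2) / (α * P.q ^ (2 * m + 2) - β)) •
      ((χ * P.q ^ m / (P.ρ * u)) • tComm P.q P.genAs P.genA
        - (β ^ 2 * P.q ^ (-m) / (u * χ)) • tComm P.q P.genA P.genAs
        + (β * (P.q ^ 2 + 1) / (P.q * u)) • P.genA
        - (β * (1 / (P.q * u ^ 3) + P.q * u)) • P.genAs
        + (P.q ^ (-m - 3) / (P.ρ * χ * bfun (P.q ^ 2)) *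
            ((P.q ^ 2 + 1) * u⁻¹ *
                (P.ω * (χ ^ 2 * P.q ^ (2 * m + 2) - β ^ 2 * P.q ^ 2 * P.ρ)
                  + β * (P.q ^ 4 - 1) * P.ηs * χ * P.q ^ m)
              - P.q ^ 2 * P.ρ * (P.q ^ 2 * u + (u ^ 3)⁻¹) *
                (β ^ 2 * P.ρ - χ ^ 2 * P.q ^ (2 * m)))) • 1)
  | .minus =>
    (bfun (u ^ 2) * P.q ^ (2 * m + 1) / (α * (P.q ^ 2)⁻¹ - β * P.q ^ (2 * m))) •
      ((u * χ * P.q ^ (-m - 1) / P.ρ) • tComm P.q P.genAs P.genA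
        - (β ^ 2 * u * P.q ^ (m - 1) / χ) • tComm P.q P.genA P.genAs
        + (β * (P.q ^ 2 * u ^ 4 + 1) / (P.q ^ 2 * u)) • P.genA
        - (β * (P.q ^ 2 + 1) * u / P.q ^ 2) • P.genAs
        - (P.q ^ (-m - 4) / (P.ρ * χ * bfun (P.q ^ 2)) *
            (P.ρ * P.q ^ 2 * (P.q ^ 2 * u ^ 3 + u⁻¹) *
                (β ^ 2 * P.ρ * P.q ^ (2 * m) - χ ^ 2)
              + (P.q ^ 2 + 1) * u *
                (P.ω * (β ^ 2 * P.ρ * P.q ^ (2 * m + 2) - P.q ^ 2 * χ ^ 2)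
                  + β * (P.q ^ 4 - 1) * P.η * χ * P.q ^ m))) • 1)

/-- The string `𝓑^ε(u₁, m + 2(M-1)) ⋯ 𝓑^ε(u_M, m)`. -/
def stringB (α β χ : ℂ) (ε : Eps) {M : ℕ} (u : Fin M → ℂ) (m : ℤ) : P.AW :=
  (List.ofFn fun i : Fin M => P.dynB α β χ ε (u i) (m + 2 * ((M : ℤ) - 1 - (i : ℤ)))).prod

/-- The condition on `α` under which the reference state is `|Ω^ε⟩`. -/
def GaugeCondition (α χ : ℂ) (ε : Eps) (m : ℤ) : Prop :=
  match ε with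
  | .plus => (P.q ^ 2 - (P.q ^ 2)⁻¹) * χ⁻¹ * α * P.cs * P.q ^ m = 1
  | .minus => (P.q ^ 2 - (P.q ^ 2)⁻¹) * χ⁻¹ * α * P.b * P.q ^ (-m) = -1

/-! ### The coefficients of the linear system -/

/-- `Λ₁^ε(u)`. -/
def Λ₁ (ε : Eps) (u : ℂ) : ℂ :=
  P.q ^ (-(P.d : ℤ) - 1) / u ^ ε.toInt
    * (P.q ^ ((P.d : ℤ) + 1) * u * P.ζ⁻¹ - u⁻¹ * P.ζ)
    * (P.q ^ ((P.d : ℤ) + 1) * u * P.ζ - u⁻¹ * P.ζ⁻¹)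
    * (u * P.cs * P.q ^ (-(P.d : ℤ)) + u⁻¹ * P.b * P.q ^ (P.d : ℤ))
    * (u * (P.c / P.cs) ^ ((1 - ε.toInt) / 2) + u⁻¹ * (P.bs / P.b) ^ ((1 + ε.toInt) / 2))

/-- `Λ₂^ε(u)`. -/
def Λ₂ (ε : Eps) (u : ℂ) : ℂ :=
  (u ^ 2 - (u ^ 2)⁻¹) * P.q ^ (-(P.d : ℤ) - 1)
      / (u ^ ε.toInt * (P.q * u ^ 2 - P.q⁻¹ * (u ^ 2)⁻¹))
    * (P.q ^ ((P.d : ℤ) - 1) * u⁻¹ * P.ζ - u * P.ζ⁻¹)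
    * (P.q ^ ((P.d : ℤ) - 1) * u⁻¹ * P.ζ⁻¹ - u * P.ζ)
    * (P.q ^ 2 * u * P.b * P.q ^ (P.d : ℤ) + u⁻¹ * P.cs * P.q ^ (-(P.d : ℤ)))
    * (P.q ^ 2 * u * (P.bs / P.b) ^ ((1 + ε.toInt) / 2)
        + u⁻¹ * (P.c / P.cs) ^ ((1 - ε.toInt) / 2))

/-- `ν₊ = q^{-1-4s} c*`. -/
def νplus : ℂ := P.q ^ (-1 - 2 * (P.d : ℤ)) * P.cs

/-- `g(u, ū) = ∏_i (b(u/u_i) b(q u u_i))⁻¹`. -/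
def g {n : ℕ} (u : ℂ) (v : Fin n → ℂ) : ℂ :=
  ∏ i, (bfun (u / v i) * bfun (P.q * u * v i))⁻¹

/-- The inhomogeneous term of `Y_ε`; it is present for `ε = +` only. -/
def inhom (ε : Eps) (u : ℂ) : ℂ :=
  match ε with
  | .plus => P.νplus * ∏ j ∈ Finset.range (P.d + 1),
      (bfun (P.sqrtq ^ (1 + 2 * (j : ℤ) - (P.d : ℤ)) * u * P.ζ)
        * bfun (P.sqrtq ^ (1 + 2 * (j : ℤ) - (P.d : ℤ)) * u * P.ζ⁻¹))
  | .minus => 0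

/-- `Y_ε(u | ū)`. -/
def Yfun (ε : Eps) {n : ℕ} (u : ℂ) (v : Fin n → ℂ) : ℂ :=
  u ^ (2 * ε.toInt + 1) * P.Λ₁ ε u / (bfun (u ^ 2) * bfun (P.q * u ^ 2))
      * ∏ i, (bfun (u / (P.q * v i)) * bfun (u * v i))
    + P.q ^ (-ε.toInt - 1) * u⁻¹ * P.Λ₂ ε u / (bfun (u ^ 2) * bfun (P.q ^ 2 * u ^ 2))
      * ∏ i, (bfun (P.q * u / v i) * bfun (P.q ^ 2 * u * v i))
    - P.inhom ε u

/-- The tuple `𝒴̄_k`: the tuple `𝒴̄ = (y_1, …, y_{2s+1})` with `y_k` removed. -/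
def removeAt (y : Fin (P.d + 1) → ℂ) (k : Fin (P.d + 1)) : Fin P.d → ℂ :=
  fun i => y (k.succAbove i)

/-- The coefficients `L^ε_{jk}`. -/
def Lcoef (ε : Eps) (y : Fin (P.d + 1) → ℂ) (j k : Fin (P.d + 1)) : ℂ :=
  (y j / y k) ^ ε.toInt * (bfun (y k ^ 2) / bfun (y j ^ 2))
      * P.g (y k) (P.removeAt y k) * P.Yfun ε (y k) (P.removeAt y j)
    + (if j = k then
        (P.q + P.q⁻¹) ^ 2 / (P.ρ * bfun (y j ^ 2) * bfun (P.q ^ 2 * y j ^ 2))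
          * (P.ηs + P.η * ((P.q * y j ^ 2 + P.q⁻¹ * (y j ^ 2)⁻¹) / (P.q + P.q⁻¹)))
      else 0)

/-- The matrix `𝓜^{ε,M}` of the linear system, `𝓜^{ε,M}_{jk} = L^ε_{jk} - δ_{jk} θ_M`. -/
def Mmat (ε : Eps) (M : ℕ) (y : Fin (P.d + 1) → ℂ) :
    Matrix (Fin (P.d + 1)) (Fin (P.d + 1)) ℂ :=
  Matrix.of fun j k => P.Lcoef ε y j k - (if j = k then P.θ M else 0)

/-- None of the denominators in the coefficients `L^ε_{jk}` vanishes. As `b(1) = 0`, this contains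
that the `y_j` are pairwise distinct. -/
def Regular (y : Fin (P.d + 1) → ℂ) : Prop :=
  (∀ j, y j ≠ 0 ∧ bfun (y j ^ 2) ≠ 0 ∧ bfun (P.q * y j ^ 2) ≠ 0
      ∧ bfun (P.q ^ 2 * y j ^ 2) ≠ 0) ∧
    ∀ j k, j ≠ k → bfun (y j / y k) ≠ 0 ∧ bfun (P.q * y j * y k) ≠ 0

end QRacahParams

/-! ### Leonard pairs and Bethe states -/

/-- Irreducible tridiagonal matrices. -/
def IsIrredTridiagonal {n : ℕ} (X : Matrix (Fin n) (Fin n) ℂ) : Prop :=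
  (∀ i j : Fin n, (i : ℕ) + 1 < j ∨ (j : ℕ) + 1 < i → X i j = 0) ∧
    ∀ i j : Fin n, (i : ℕ) + 1 = j ∨ (j : ℕ) + 1 = i → X i j ≠ 0

/-- A representation `π` of the Askey-Wilson algebra on `V` for which `(π(A), π(A*))` is a Leonard
pair with the multiplicity-free eigenvalue sequences `θ_0, …, θ_{2s}` and `θ*_0, …, θ*_{2s}`,
together with corresponding eigenbases `|θ_M⟩` and `|θ*_N⟩`. -/
structure LeonardRep (P : QRacahParams) (V : Type*) [AddCommGroup V] [Module ℂ V] where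
  π : P.AW →ₐ[ℂ] Module.End ℂ V
  ket : Module.Basis (Fin (P.d + 1)) ℂ V
  ketStar : Module.Basis (Fin (P.d + 1)) ℂ V
  θ_injective : Function.Injective fun M : Fin (P.d + 1) => P.θ M
  θs_injective : Function.Injective fun N : Fin (P.d + 1) => P.θs N
  A_ket : ∀ M : Fin (P.d + 1), π P.genA (ket M) = P.θ M • ket M
  As_ketStar : ∀ N : Fin (P.d + 1), π P.genAs (ketStar N) = P.θs N • ketStar N
  As_tridiagonal : IsIrredTridiagonal (LinearMap.toMatrix ket ket (π P.genAs))
  A_tridiagonal : IsIrredTridiagonal (LinearMap.toMatrix ketStar ketStar (π P.genA))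

namespace LeonardRep

variable {P : QRacahParams} {V : Type*} [AddCommGroup V] [Module ℂ V] (R : LeonardRep P V)

/-- The reference states `|Ω⁺⟩ = |θ*_0⟩` and `|Ω⁻⟩ = |θ_0⟩`. -/
def refState (ε : Eps) : V :=
  match ε with
  | .plus => R.ketStar 0
  | .minus => R.ket 0

/-- The Bethe state `|Ψ_ε^M(ū, m)⟩ = π(B^ε(ū, m, M)) |Ω^ε⟩` at `β = 0`. -/
def betheState (α χ : ℂ) (ε : Eps) {M : ℕ} (u : Fin M → ℂ) (m : ℤ) : V :=
  R.π (P.stringB α 0 χ ε u m) (R.refState ε)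

/-- `bra` is a covector `⟨θ_M|`: a nonzero linear functional with `⟨θ_M| A = θ_M ⟨θ_M|`. -/
def IsBra (M : Fin (P.d + 1)) (bra : Module.Dual ℂ V) : Prop :=
  bra ≠ 0 ∧ bra ∘ₗ R.π P.genA = P.θ M • bra

/-- The normalized scalar product `X_M^{ε,off}(ū) = ⟨θ_M|Ψ_ε^{2s}(ū, m)⟩ / ⟨θ_M|θ_M⟩`. -/
def X (α χ : ℂ) (ε : Eps) (m : ℤ) (M : Fin (P.d + 1)) (bra : Module.Dual ℂ V)
    (u : Fin P.d → ℂ) : ℂ :=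
  bra (R.betheState α χ ε u m) / bra (R.ket M)

end LeonardRep

end LeonardBethe

end

/-! At `β = 0` each dynamical operator is a scalar multiple of `E - w(u)`, where `E` (`thirdEnd`) is
affine in `[A*, A]_q` and `w(u) = q u² + (q u²)⁻¹` (`map_dynB`). An off-shell Bethe state is
therefore a scalar times `p(E) Ω` with `p = ∏ (X - w(u_i))`, and the question is how `A` acts on
such vectors.

The Askey-Wilson relations make the `q`-commutators of `A, E` and of `E, A*` affine in the remaining
operator, hence give a relation between `A` and `E` that is quadratic in `E` and linear in `A`.
Together with `A Ω` and `A E Ω` it determines a linear operator `T` on polynomials with `A p(E) Ω =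
(T p)(E) Ω` (`apply_aeval`). The two initial values come from tridiagonality and from the first
diagonal entry of the tridiagonal operator (`first_diag_entry`). At the point `w(u)`, `T` is a
second order `q`-difference operator in `u` whose coefficients are those of `Y_ε` and of the
diagonal term (`eval_actionOp`). Lagrange interpolation at the `d + 1` points `w(y_k)` expands `T p`
in the polynomials belonging to the tuples with one entry removed, and this produces `L_{jk}`.

Interpolation requires degree at most `d`. For `ε = -`, `Ω` is an eigenvector of `A` and `T` does
not raise degrees. For `ε = +` it raises them by one, with leading coefficient `ν₊` on monic
polynomials of degree `d`; subtracting `ν₊ Φ` with `Φ = thirdChar` restores the degree and is the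
inhomogeneous term. It changes nothing because `Φ(E) Ω = 0` (`aeval_thirdChar`). To see this without
diagonalizing `E`, compare `Φ` with the characteristic polynomial of `E`: the trace of `A` makes
their second coefficients agree, and `T Φ` is a linear polynomial times `Φ`, which excludes any
lower order contribution to `Φ(E) Ω`.

The linear system is the off-shell action paired with `⟨θ_M|`. -/

open Polynomial

namespace LeonardBethe

/-! ### Operators on polynomials defined by a second order recursion -/

/-- The images of the powers of the variable under `polyOp`. -/
noncomputable def opSeq (Q₀ Q₁ : ℂ[X]) (t k e₀ e₁ : ℂ) : ℕ → ℂ[X]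
  | 0 => Q₀
  | 1 => Q₁
  | n + 2 => C t * X * opSeq Q₀ Q₁ t k e₀ e₁ (n + 1) - X ^ 2 * opSeq Q₀ Q₁ t k e₀ e₁ n
      - C k * opSeq Q₀ Q₁ t k e₀ e₁ n - (C e₀ + C e₁ * X) * X ^ n

/-- The linear operator on polynomials with `1 ↦ Q₀` and `X ↦ Q₁` that satisfies the
Askey-Wilson relation with multiplication by `X`. -/
noncomputable def polyOp (Q₀ Q₁ : ℂ[X]) (t k e₀ e₁ : ℂ) : ℂ[X] →ₗ[ℂ] ℂ[X] :=
  (Polynomial.basisMonomials ℂ).constr ℂ (opSeq Q₀ Q₁ t k e₀ e₁)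

lemma polyOp_X_pow (Q₀ Q₁ : ℂ[X]) (t k e₀ e₁ : ℂ) (n : ℕ) :
    polyOp Q₀ Q₁ t k e₀ e₁ (X ^ n) = opSeq Q₀ Q₁ t k e₀ e₁ n := by
  have := (Polynomial.basisMonomials ℂ).constr_basis ℂ (opSeq Q₀ Q₁ t k e₀ e₁) n
  simpa [polyOp, Polynomial.coe_basisMonomials, Polynomial.monomial_one_right_eq_X_pow] using this

lemma polyOp_eq_sum (Q₀ Q₁ : ℂ[X]) (t k e₀ e₁ : ℂ) {p : ℂ[X]} {n : ℕ} (hp : p.natDegree ≤ n) :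
    polyOp Q₀ Q₁ t k e₀ e₁ p
      = ∑ i ∈ Finset.range (n + 1), p.coeff i • opSeq Q₀ Q₁ t k e₀ e₁ i := by
  conv_lhs => rw [p.as_sum_range' (n + 1) (by omega)]
  rw [map_sum]
  refine Finset.sum_congr rfl fun i _ => ?_
  rw [← C_mul_X_pow_eq_monomial, ← smul_eq_C_mul, map_smul, polyOp_X_pow]

lemma linearMap_eq_of_X_pow {W : Type*} [AddCommGroup W] [Module ℂ W] {f g : ℂ[X] →ₗ[ℂ] W}
    (h : ∀ n, f (X ^ n) = g (X ^ n)) : f = g := by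
  refine (Polynomial.basisMonomials ℂ).ext fun n => ?_
  simpa [Polynomial.monomial_one_right_eq_X_pow] using h n

lemma natDegree_sub_le_same {p r : ℂ[X]} {n : ℕ} (hp : p.natDegree ≤ n) (hr : r.natDegree ≤ n) :
    (p - r).natDegree ≤ n :=
  (natDegree_sub_le_of_le hp hr).trans (max_self n).le

lemma two_step_induction {p : ℕ → Prop} (h0 : p 0) (h1 : p 1)
    (h : ∀ n, p n → p (n + 1) → p (n + 2)) (n : ℕ) : p n := by
  have : p n ∧ p (n + 1) := by
    induction n with
    | zero => exact ⟨h0, h1⟩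
    | succ n ih => exact ⟨ih.2, h n ih.1 ih.2⟩
  exact this.1

/-- Applied to `E ^ n Ω`, the relation `hrel` expresses `A E ^ (n + 2) Ω` through the two preceding
values; `opSeq` is this recursion. -/
lemma apply_aeval_eq_polyOp {V : Type*} [AddCommGroup V] [Module ℂ V]
    {A E : Module.End ℂ V} {Ω : V} {Q₀ Q₁ : ℂ[X]} {t k e₀ e₁ : ℂ}
    (h0 : A Ω = aeval E Q₀ Ω) (h1 : A (E Ω) = aeval E Q₁ Ω)
    (hrel : E * E * A - t • (E * A * E) + A * E * E + k • A + e₀ • 1 + e₁ • E = 0) (p : ℂ[X]) :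
    A (aeval E p Ω) = aeval E (polyOp Q₀ Q₁ t k e₀ e₁ p) Ω := by
  let ev : ℂ[X] →ₗ[ℂ] V := (LinearMap.applyₗ Ω) ∘ₗ (aeval E).toLinearMap
  suffices A ∘ₗ ev = ev ∘ₗ polyOp Q₀ Q₁ t k e₀ e₁ from LinearMap.congr_fun this p
  refine linearMap_eq_of_X_pow fun n => ?_
  simp only [LinearMap.comp_apply, polyOp_X_pow]
  change A (aeval E (X ^ n) Ω) = aeval E _ Ω
  induction n using two_step_induction with
  | h0 => simpa [opSeq] using h0
  | h1 => simpa [opSeq] using h1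
  | h n ih0 ih1 =>
    have hv := LinearMap.congr_fun hrel (aeval E (X ^ n : ℂ[X]) Ω)
    have e2 : aeval E (X ^ (n + 2) : ℂ[X]) Ω = E (E (aeval E (X ^ n : ℂ[X]) Ω)) := by
      simp only [map_pow, aeval_X, Module.End.pow_apply, Function.iterate_succ_apply']
    have e1 : aeval E (X ^ (n + 1) : ℂ[X]) Ω = E (aeval E (X ^ n : ℂ[X]) Ω) := by
      simp only [map_pow, aeval_X, Module.End.pow_apply, Function.iterate_succ_apply']
    rw [e1] at ih1
    rw [e2]
    simp only [LinearMap.add_apply, LinearMap.sub_apply, Module.End.mul_apply,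
      LinearMap.smul_apply, Module.End.one_apply, LinearMap.zero_apply, ih0, ih1] at hv
    simp only [opSeq, map_sub, map_mul, map_add, map_pow, aeval_X, aeval_C, pow_two,
      LinearMap.add_apply, LinearMap.sub_apply, Module.End.mul_apply,
      Module.algebraMap_end_apply] at hv ⊢
    linear_combination (norm := module) hv

/-- Both `xm` and `xp` are roots of `z² - t x z + x² + k`, so their powers solve the homogeneous
recursion at `x`, while `H x ^ n` is a particular solution that absorbs `e₀ + e₁ x`. The values at
`n = 0, 1` fix the combination. -/
lemma eval_polyOp {Q₀ Q₁ : ℂ[X]} {t k e₀ e₁ x xm xp F G H : ℂ}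
    (h0 : Q₀.eval x = F + G + H) (h1 : Q₁.eval x = F * xm + G * xp + H * x)
    (hm : xm ^ 2 = t * x * xm - x ^ 2 - k) (hp : xp ^ 2 = t * x * xp - x ^ 2 - k)
    (hH : H * x ^ 2 = t * x * (H * x) - x ^ 2 * H - k * H - (e₀ + e₁ * x)) (p : ℂ[X]) :
    (polyOp Q₀ Q₁ t k e₀ e₁ p).eval x = F * p.eval xm + G * p.eval xp + H * p.eval x := by
  suffices Polynomial.leval x ∘ₗ polyOp Q₀ Q₁ t k e₀ e₁
      = F • Polynomial.leval xm + G • Polynomial.leval xp + H • Polynomial.leval x by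
    simpa using LinearMap.congr_fun this p
  refine linearMap_eq_of_X_pow fun n => ?_
  simp only [LinearMap.comp_apply, polyOp_X_pow, LinearMap.add_apply, LinearMap.smul_apply,
    Polynomial.leval_apply, eval_pow, eval_X, smul_eq_mul]
  induction n using two_step_induction with
  | h0 => simpa [opSeq] using h0
  | h1 => simpa [opSeq] using h1
  | h n ih0 ih1 =>
    simp only [opSeq, eval_sub, eval_mul, eval_add, eval_C, eval_X, eval_pow, ih0, ih1, pow_add]
    linear_combination (-F * xm ^ n) * hm - G * xp ^ n * hp - x ^ n * hH

lemma polyOp_degree_le {Q₀ Q₁ : ℂ[X]} {t k e₀ e₁ : ℂ} (h0 : Q₀.natDegree ≤ 0)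
    (h1 : Q₁.natDegree ≤ 1) {p : ℂ[X]} {n : ℕ} (hp : p.natDegree ≤ n) :
    (polyOp Q₀ Q₁ t k e₀ e₁ p).natDegree ≤ n := by
  have key : ∀ m, (opSeq Q₀ Q₁ t k e₀ e₁ m).natDegree ≤ m := by
    intro m
    induction m using two_step_induction with
    | h0 => exact h0
    | h1 => exact h1
    | h m ih0 ih1 =>
      simp only [opSeq]
      refine natDegree_sub_le_same (natDegree_sub_le_same (natDegree_sub_le_same ?_ ?_) ?_) ?_
      · exact (natDegree_mul_le_of_le ((natDegree_C_mul_le t X).trans natDegree_X_le) ih1).trans (by omega)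
      · exact (natDegree_mul_le_of_le (natDegree_X_pow_le 2) ih0).trans (by omega)
      · exact (natDegree_C_mul_le _ _).trans (ih0.trans (by omega))
      · refine (natDegree_mul_le_of_le (natDegree_add_le_of_degree_le (n := 1)
          (p := C e₀) (q := C e₁ * X) (by simp) ((natDegree_C_mul_le e₁ X).trans natDegree_X_le))
          (natDegree_X_pow_le m)).trans (by omega)
  rw [polyOp_eq_sum _ _ _ _ _ _ hp]
  refine natDegree_sum_le_of_forall_le _ _ fun i hi => ?_
  exact (natDegree_smul_le _ _).trans ((key i).trans (by simpa [Nat.lt_succ_iff] using hi))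

/-- `Q` has degree at most `n + 1`, with the prescribed coefficients of degree `n + 1` and `n`. -/
def HasTop (Q : ℂ[X]) (n : ℕ) (a b : ℂ) : Prop :=
  Q.natDegree ≤ n + 1 ∧ Q.coeff (n + 1) = a ∧ Q.coeff n = b

/-- The terms with `k`, `e₀`, `e₁` have too low a degree to matter, so both top coefficients satisfy
`c (n + 2) = (q² + q⁻²) c (n + 1) - c n`. The characteristic roots are `q²` and `q⁻²`, and the
initial values select `q⁻²`. -/
lemma opSeq_hasTop {q ν β k e₀ e₁ γ : ℂ} (hq : q ≠ 0) (n : ℕ) :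
    HasTop (opSeq (C ν * X + C β) (C ((q ^ 2)⁻¹) * X * (C ν * X + C β) + C γ)
      (q ^ 2 + (q ^ 2)⁻¹) k e₀ e₁ n) n (ν * ((q ^ 2)⁻¹) ^ n) (β * ((q ^ 2)⁻¹) ^ n) := by
  induction n using two_step_induction with
  | h0 =>
    refine ⟨by simp only [opSeq]; compute_degree, ?_, ?_⟩ <;> simp [opSeq]
  | h1 =>
    refine ⟨by simp only [opSeq]; compute_degree, ?_, ?_⟩ <;>
      simp [opSeq, mul_add, coeff_X, coeff_C, mul_assoc] <;> ring
  | h m ih0 ih1 =>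
    obtain ⟨d0, a0, b0⟩ := ih0
    obtain ⟨d1, a1, b1⟩ := ih1
    set S := opSeq (C ν * X + C β) (C ((q ^ 2)⁻¹) * X * (C ν * X + C β) + C γ)
      (q ^ 2 + (q ^ 2)⁻¹) k e₀ e₁ with hS
    have hs : S (m + 2) = C (q ^ 2 + (q ^ 2)⁻¹) * (X * S (m + 1)) - X ^ 2 * S m - C k * S m
        - (C e₀ * X ^ m + C e₁ * X ^ (m + 1)) := by
      rw [hS]; simp only [opSeq]; ring
    have z2 : (S m).coeff (m + 2) = 0 := coeff_eq_zero_of_natDegree_lt (by omega)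
    have z3 : (S m).coeff (m + 3) = 0 := coeff_eq_zero_of_natDegree_lt (by omega)
    have hq2 : q ^ 2 ≠ 0 := pow_ne_zero _ hq
    refine ⟨?_, ?_, ?_⟩
    · simp only [hs]
      refine natDegree_sub_le_same (natDegree_sub_le_same (natDegree_sub_le_same ?_ ?_) ?_) ?_
      · refine (natDegree_C_mul_le _ _).trans ?_
        exact (natDegree_mul_le_of_le (natDegree_X_le (R := ℂ)) d1).trans (by omega)
      · exact (natDegree_mul_le_of_le (natDegree_X_pow_le 2) d0).trans (by omega)
      · exact (natDegree_C_mul_le _ _).trans (d0.trans (by omega))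
      · refine natDegree_add_le_of_degree_le ?_ ?_
        · exact (natDegree_C_mul_X_pow_le _ _).trans (by omega)
        · exact (natDegree_C_mul_X_pow_le _ _).trans (by omega)
    · have c1 : (X ^ 2 * S m).coeff (m + 2 + 1) = (S m).coeff (m + 1) := by
        rw [show m + 2 + 1 = m + 1 + 2 by ring, coeff_X_pow_mul]
      rw [hs]
      simp only [coeff_sub, coeff_C_mul, coeff_add, coeff_X_mul, c1, a1, a0, z3, coeff_X_pow]
      rw [if_neg (by omega), if_neg (by omega)]
      linear_combination (ν * (q ^ 2)⁻¹ ^ m) * mul_inv_cancel₀ hq2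
    · have c1 : (X ^ 2 * S m).coeff (m + 2) = (S m).coeff m := coeff_X_pow_mul _ _ _
      rw [hs]
      simp only [coeff_sub, coeff_C_mul, coeff_add, coeff_X_mul, c1, b1, b0, z2, coeff_X_pow]
      rw [if_neg (by omega), if_neg (by omega)]
      linear_combination (β * (q ^ 2)⁻¹ ^ m) * mul_inv_cancel₀ hq2

lemma polyOp_top {q ν β k e₀ e₁ γ : ℂ} (hq : q ≠ 0) {p : ℂ[X]} {n : ℕ} (hp : p.natDegree ≤ n) :
    (polyOp (C ν * X + C β) (C ((q ^ 2)⁻¹) * X * (C ν * X + C β) + C γ)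
      (q ^ 2 + (q ^ 2)⁻¹) k e₀ e₁ p).natDegree ≤ n + 1 ∧
    (polyOp (C ν * X + C β) (C ((q ^ 2)⁻¹) * X * (C ν * X + C β) + C γ)
      (q ^ 2 + (q ^ 2)⁻¹) k e₀ e₁ p).coeff (n + 1) = ν * ((q ^ 2)⁻¹) ^ n * p.coeff n := by
  have key := fun m => opSeq_hasTop (ν := ν) (β := β) (k := k) (e₀ := e₀) (e₁ := e₁) (γ := γ) hq m
  rw [polyOp_eq_sum _ _ _ _ _ _ hp]
  constructor
  · refine natDegree_sum_le_of_forall_le _ _ fun i hi => ?_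
    have hi' : i < n + 1 := by simpa using hi
    exact (natDegree_smul_le _ _).trans ((key i).1.trans (by omega))
  · simp only [finsetSum_coeff, coeff_smul, smul_eq_mul]
    rw [Finset.sum_range_succ, (key n).2.1, Finset.sum_eq_zero, zero_add, mul_comm]
    intro i hi
    rw [coeff_eq_zero_of_natDegree_lt (p := opSeq _ _ _ _ _ _ i), mul_zero]
    have := (key i).1
    have hi' : i < n := by simpa using hi
    omega

/-! ### Interpolation -/

/-- Lagrange interpolation, written in the monic node polynomials because these are the ones that
give Bethe states. -/
lemma eq_sum_interpolation {d : ℕ} {w : Fin (d + 1) → ℂ} (hw : Function.Injective w)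
    {Q : ℂ[X]} (hQ : Q.natDegree ≤ d) :
    Q = ∑ k, C (Q.eval (w k) * ∏ i : Fin d, (w k - w (k.succAbove i))⁻¹)
      * ∏ i : Fin d, (X - C (w (k.succAbove i))) := by
  refine Polynomial.eq_of_degrees_lt_of_eval_index_eq (s := Finset.univ) (v := w) (f := Q)
    hw.injOn ?_ ?_ ?_
  · rw [Finset.card_univ, Fintype.card_fin]
    exact (degree_le_of_natDegree_le hQ).trans_lt (by exact_mod_cast Nat.lt_succ_self d)
  · rw [Finset.card_univ, Fintype.card_fin]
    refine lt_of_le_of_lt (degree_le_of_natDegree_le (n := d) ?_)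
      (by exact_mod_cast Nat.lt_succ_self d)
    refine natDegree_sum_le_of_forall_le _ _ fun k _ => ?_
    refine (natDegree_C_mul_le _ _).trans ?_
    refine (natDegree_prod_le _ _).trans ?_
    simp
  · intro j _
    simp only [eval_finsetSum, eval_mul, eval_C, eval_prod, eval_sub, eval_X]
    rw [Finset.sum_eq_single j]
    · rw [mul_assoc, ← Finset.prod_mul_distrib, Finset.prod_eq_one, mul_one]
      intro i _
      refine inv_mul_cancel₀ (sub_ne_zero.mpr fun h => ?_)
      exact (Fin.succAbove_ne j i) (hw h).symm
    · intro k _ hk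
      obtain ⟨i, hi⟩ := Fin.exists_succAbove_eq (Ne.symm hk)
      rw [Finset.prod_eq_zero (f := fun i => w j - w (k.succAbove i)) (Finset.mem_univ i)
        (by simp only [hi, sub_self]), mul_zero]
    · simp


/-! ### The third generator of the Askey-Wilson algebra -/

section Ring

variable {R : Type*} [Ring R] [Algebra ℂ R]

/-- The normalized third generator: an affine function of `[A*, A]_q`. -/
noncomputable def thirdGen (q ρ ω : ℂ) (A As : R) : R :=
  -ρ⁻¹ • ((q ^ 2 - (q ^ 2)⁻¹) • tComm q As A + ((q + q⁻¹) * ω) • (1 : R))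

lemma map_tComm {S : Type*} [Ring S] [Algebra ℂ S] (f : R →ₐ[ℂ] S) (t : ℂ) (X Y : R) :
    f (tComm t X Y) = tComm t (f X) (f Y) := by
  simp [tComm]

variable {q ρ ω η : ℂ} {A As : R}

/-- The normalization of `thirdGen` is the one for which this relation and the next carry the same
factor `q² - q⁻²`. Each is an Askey-Wilson relation solved for its linear term. -/
lemma qComm_left_thirdGen (hq : q ≠ 0) (hρ : ρ ≠ 0)
    (h : tComm q⁻¹ A (tComm q A As) = ρ • As + ω • A + η • (1 : R)) :
    q • (A * thirdGen q ρ ω A As) - q⁻¹ • (thirdGen q ρ ω A As * A)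
      = (q ^ 2 - (q ^ 2)⁻¹) • (As + (η / ρ) • (1 : R)) := by
  have h' : As = ρ⁻¹ • (tComm q⁻¹ A (tComm q A As) - ω • A - η • (1 : R)) := by
    rw [h]
    match_scalars <;> field_simp <;> ring
  conv_rhs => rw [h']
  simp only [thirdGen, tComm, mul_sub, sub_mul, mul_add, add_mul, smul_mul_assoc, mul_smul_comm,
    mul_one, one_mul, smul_sub, smul_add, smul_smul, mul_assoc]
  match_scalars <;> field_simp <;> ring

lemma qComm_thirdGen_right (hq : q ≠ 0) (hρ : ρ ≠ 0)
    (h : tComm q⁻¹ As (tComm q As A) = ρ • A + ω • As + η • (1 : R)) :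
    q • (thirdGen q ρ ω A As * As) - q⁻¹ • (As * thirdGen q ρ ω A As)
      = (q ^ 2 - (q ^ 2)⁻¹) • (A + (η / ρ) • (1 : R)) := by
  have h' : A = ρ⁻¹ • (tComm q⁻¹ As (tComm q As A) - ω • As - η • (1 : R)) := by
    rw [h]
    match_scalars <;> field_simp <;> ring
  conv_rhs => rw [h']
  simp only [thirdGen, tComm, mul_sub, sub_mul, mul_add, add_mul, smul_mul_assoc, mul_smul_comm,
    mul_one, one_mul, smul_sub, smul_add, smul_smul, mul_assoc]
  match_scalars <;> field_simp <;> ring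

/-- Elimination of `B`: in `q E h1 - q⁻¹ h1 E` the right side contains `q E B - q⁻¹ B E`, which `h2`
makes affine in `A`. -/
lemma cubic_of_qComm {B E : R} {b₂ x y : ℂ} (hq : q ≠ 0)
    (h1 : q • (A * E) - q⁻¹ • (E * A) = b₂ • (B + x • (1 : R)))
    (h2 : q • (E * B) - q⁻¹ • (B * E) = b₂ • (A + y • (1 : R))) :
    E * E * A - (q ^ 2 + (q ^ 2)⁻¹) • (E * A * E) + A * E * E + b₂ ^ 2 • A
      + (b₂ ^ 2 * y) • (1 : R) + (b₂ * (q - q⁻¹) * x) • E = 0 := by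
  have e1 := congrArg (fun z => q • (E * z)) h1
  have e2 := congrArg (fun z => q⁻¹ • (z * E)) h1
  simp only [mul_sub, sub_mul, mul_add, add_mul, smul_mul_assoc, mul_smul_comm, mul_one, one_mul,
    mul_assoc] at e1 e2 ⊢
  linear_combination (norm := skip) -e1 + e2 - b₂ • h2
  match_scalars <;> field_simp <;> ring

lemma doubleComm_expand (hq : q ≠ 0)
    (h : tComm q⁻¹ As (tComm q As A) = ρ • A + ω • As + η • (1 : R)) :
    As * As * A - (q ^ 2 + (q ^ 2)⁻¹) • (As * A * As) + A * As * As
      = ρ • A + ω • As + η • (1 : R) := by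
  rw [← h]
  simp only [tComm, mul_sub, sub_mul, smul_mul_assoc, mul_smul_comm, smul_sub, mul_assoc]
  match_scalars <;> field_simp <;> ring

end Ring

/-! ### The first diagonal entry -/

lemma pow_sub_inv_ne_zero {q : ℂ} (hq0 : q ≠ 0) (hq : ∀ n : ℕ, 0 < n → q ^ n ≠ 1) {n : ℕ}
    (hn : 0 < n) : q ^ n - (q ^ n)⁻¹ ≠ 0 := by
  intro h
  have h1 : q ^ n ≠ 0 := pow_ne_zero _ hq0
  apply hq (n * 2) (by omega)
  rw [pow_mul, pow_two]
  nth_rewrite 2 [sub_eq_zero.mp h]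
  exact mul_inv_cancel₀ h1

lemma pow_add_inv_ne_zero {q : ℂ} (hq0 : q ≠ 0) (hq : ∀ n : ℕ, 0 < n → q ^ n ≠ 1) {n : ℕ}
    (hn : 0 < n) : q ^ n + (q ^ n)⁻¹ ≠ 0 := by
  intro h
  have h1 : q ^ n ≠ 0 := pow_ne_zero _ hq0
  apply hq (n * 4) (by omega)
  have h2 : (q ^ n) ^ 2 = -1 := by
    rw [pow_two]
    nth_rewrite 2 [eq_neg_of_add_eq_zero_left h]
    rw [mul_neg, mul_inv_cancel₀ h1]
  rw [pow_mul, show (4 : ℕ) = 2 * 2 from rfl, pow_mul, h2]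
  norm_num

/-- The diagonal entries of the tridiagonal operator in the dual eigenbasis satisfy a linear
equation, which determines the first one unless it degenerates; then the trace determines it. -/
lemma first_diag_entry {d : ℕ} {q β γ T ψ Q τ N : ℂ} (hq0 : q ≠ 0)
    (hq : ∀ n : ℕ, 0 < n → q ^ n ≠ 1) (hγ : γ ≠ 0) (hQ : Q = q ^ d) (hτ : τ = β * Q + γ * Q⁻¹)
    (hN : N = q * Q + (q * Q)⁻¹) (a : Fin (d + 1) → ℂ)
    (ha : ∀ i : Fin (d + 1), ∀ t, t = β * (q ^ (i : ℕ)) ^ 2 + γ * ((q ^ (i : ℕ)) ^ 2)⁻¹ →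
      t ^ 2 * a i = (q + q⁻¹) ^ 2 * (β * γ) * a i + (T * τ - N * ψ) * t
        + (q + q⁻¹) * (τ * ψ - N * (β * γ) * T))
    (htr : (q - q⁻¹) * ∑ i, a i = T * (q * Q - (q * Q)⁻¹)) :
    a 0 * (β * q - γ * q⁻¹) = T * (β * (q * Q) - γ * (q * Q)⁻¹) + (Q - Q⁻¹) * ψ := by
  have hQ0 : Q ≠ 0 := hQ ▸ pow_ne_zero _ hq0
  -- At `i = 0` the coefficient of `a 0` in `ha` is `(β q⁻¹ - γ q) (β q - γ q⁻¹)`. If the first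
  -- factor is nonzero it can be cancelled; otherwise that equation says nothing about `a 0`, which
  -- is then the trace minus the other entries.
  by_cases hg : β * q⁻¹ - γ * q = 0
  · have hβ : β = γ * q ^ 2 := by
      field_simp at hg
      linear_combination hg
    have hs1 : q - q⁻¹ ≠ 0 := by simpa using pow_sub_inv_ne_zero hq0 hq (n := 1) one_pos
    have hp1 : q + q⁻¹ ≠ 0 := by simpa using pow_add_inv_ne_zero hq0 hq (n := 1) one_pos
    have hN0 : N ≠ 0 := by
      rw [hN, hQ, ← pow_succ']
      exact pow_add_inv_ne_zero hq0 hq d.succ_pos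
    -- A hyperbolic tangent in disguise: the addition formula makes the entries with positive index
    -- differences of consecutive values of `f`, so their sum telescopes.
    let f : ℕ → ℂ := fun i => (q ^ (i + 1) - (q ^ (i + 1))⁻¹) / (q ^ (i + 1) + (q ^ (i + 1))⁻¹)
    have hstep : ∀ i : Fin d, a i.succ
        = N * (T - ψ / (q * γ)) / (2 * (q - q⁻¹)) * (f (i + 1) - f i) := by
      intro i
      have h := ha i.succ _ rfl
      simp only [f]
      have hs := pow_sub_inv_ne_zero hq0 hq (n := i + 1) (Nat.succ_pos _)
      have hs' := pow_sub_inv_ne_zero hq0 hq (n := i + 1 + 1) (Nat.succ_pos _)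
      have hp := pow_add_inv_ne_zero hq0 hq (n := i + 1) (Nat.succ_pos _)
      have hp' := pow_add_inv_ne_zero hq0 hq (n := i + 1 + 1) (Nat.succ_pos _)
      have hy0 : q ^ ((i : ℕ) + 1) ≠ 0 := pow_ne_zero _ hq0
      rw [Fin.val_succ] at h
      rw [pow_succ' q (i + 1)] at hs' hp' ⊢
      generalize q ^ ((i : ℕ) + 1) = y at *
      have hmul : (γ ^ 2 * q ^ 2 * (y - y⁻¹) * (q * y - (q * y)⁻¹))
          * (a i.succ * ((y + y⁻¹) * (q * y + (q * y)⁻¹)))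
          = (γ ^ 2 * q ^ 2 * (y - y⁻¹) * (q * y - (q * y)⁻¹)) * (N * (T - ψ / (q * γ))) := by
        subst hβ
        have hτ' : τ = γ * q * N := by rw [hτ, hN]; field_simp
        rw [hτ'] at h
        clear hτ hτ' hN htr ha hs hs' hp hp'
        field_simp at h ⊢
        linear_combination h
      have hne : γ ^ 2 * q ^ 2 * (y - y⁻¹) * (q * y - (q * y)⁻¹) ≠ 0 := by positivity
      have h3 := mul_left_cancel₀ hne hmul
      have h4 : a i.succ = N * (T - ψ / (q * γ)) / ((y + y⁻¹) * (q * y + (q * y)⁻¹)) := by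
        rw [eq_div_iff (mul_ne_zero hp hp'), h3]
      have h5 : (q * y - (q * y)⁻¹) / (q * y + (q * y)⁻¹) - (y - y⁻¹) / (y + y⁻¹)
          = 2 * (q - q⁻¹) / ((y + y⁻¹) * (q * y + (q * y)⁻¹)) := by
        rw [div_sub_div _ _ hp' hp, div_eq_div_iff (mul_ne_zero hp' hp) (mul_ne_zero hp hp')]
        field_simp
        ring
      rw [h4, h5]
      generalize (y + y⁻¹) * (q * y + (q * y)⁻¹) = D
      generalize q - q⁻¹ = S at hs1
      field_simp
    have hsum : ∑ i : Fin d, a i.succ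
        = N * (T - ψ / (q * γ)) / (2 * (q - q⁻¹)) * (f d - f 0) := by
      rw [Finset.sum_congr rfl fun i _ => hstep i, ← Finset.mul_sum,
        Fin.sum_univ_eq_sum_range (fun i => f (i + 1) - f i), Finset.sum_range_sub]
    rw [Fin.sum_univ_succ, hsum] at htr
    have hfd : f d = (q * Q - (q * Q)⁻¹) / N := by simp only [f]; rw [hN, hQ, ← pow_succ']
    have hf0 : f 0 = (q - q⁻¹) / (q + q⁻¹) := by simp [f]
    rw [hfd, hf0] at htr
    have h6 : N * (T - ψ / (q * γ)) / (2 * (q - q⁻¹))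
        * ((q * Q - (q * Q)⁻¹) / N - (q - q⁻¹) / (q + q⁻¹)) * (q - q⁻¹)
        = (T - ψ / (q * γ)) / 2 * ((q * Q - (q * Q)⁻¹) - N * (q - q⁻¹) / (q + q⁻¹)) := by
      generalize q - q⁻¹ = S at hs1
      generalize q + q⁻¹ = S' at hp1
      field_simp
    have h7 : (q - q⁻¹) * a 0 = T * (q * Q - (q * Q)⁻¹)
        - (T - ψ / (q * γ)) / 2 * ((q * Q - (q * Q)⁻¹) - N * (q - q⁻¹) / (q + q⁻¹)) := by
      linear_combination htr - h6
    apply mul_left_cancel₀ hs1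
    rw [← mul_assoc, h7, hβ, hN]
    have hp1' : q ^ 2 + 1 ≠ 0 := by
      intro h0
      apply hp1
      field_simp
      rw [h0, mul_zero]
    field_simp
    ring
  · apply mul_left_cancel₀ hg
    have h := ha 0 _ rfl
    simp only [Fin.val_zero, pow_zero, one_pow, inv_one, mul_one] at h
    rw [hτ, hN] at h
    field_simp at h ⊢
    linear_combination h


/-! ### Linear algebra of tridiagonal and Hessenberg operators -/

section Leonard

variable {V : Type*} [AddCommGroup V] [Module ℂ V] {d : ℕ}

lemma trace_eq_sum_repr (e : Module.Basis (Fin (d + 1)) ℂ V) (f : Module.End ℂ V) :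
    LinearMap.trace ℂ V f = ∑ i, e.repr (f (e i)) i := by
  rw [LinearMap.trace_eq_matrix_trace ℂ e]
  simp [Matrix.trace, LinearMap.toMatrix_apply]

/-! ### Tridiagonal operators in the eigenbasis of another one -/

section Diagonal

variable {e : Module.Basis (Fin (d + 1)) ℂ V} {A B : Module.End ℂ V} {t : ℕ → ℂ}

lemma repr_diagonal (hB : ∀ i, B (e i) = t i • e i) (v : V) (i : Fin (d + 1)) :
    e.repr (B v) i = t i * e.repr v i := by
  suffices e.coord i ∘ₗ B = t i • e.coord i by simpa using LinearMap.congr_fun this v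
  refine e.ext fun j => ?_
  simp only [LinearMap.comp_apply, hB, map_smul, LinearMap.smul_apply, Module.Basis.coord_apply,
    Module.Basis.repr_self, smul_eq_mul]
  by_cases h : j = i
  · rw [h]
  · simp [h]

lemma diag_relation (hB : ∀ i, B (e i) = t i • e i) {s ρ ω η : ℂ}
    (h : B * B * A - s • (B * A * B) + A * B * B
      = ρ • A + ω • B + η • (1 : Module.End ℂ V)) (i : Fin (d + 1)) :
    (2 - s) * t i ^ 2 * e.repr (A (e i)) i = ρ * e.repr (A (e i)) i + ω * t i + η := by
  have h1 := congrArg (fun v => e.repr v i) (LinearMap.congr_fun h (e i))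
  simp only [LinearMap.add_apply, LinearMap.sub_apply, LinearMap.smul_apply, Module.End.mul_apply,
    Module.End.one_apply, hB, map_add, map_sub, map_smul, Finsupp.add_apply, Finsupp.sub_apply,
    Finsupp.smul_apply, repr_diagonal hB, Module.Basis.repr_self, Finsupp.single_eq_same,
    smul_eq_mul] at h1
  linear_combination h1

/-- Without its diagonal component, `A (e 0)` is a multiple of the next basis vector. For `d = 0` it
is zero, and the value of `t 1` is immaterial. -/
lemma tridiagonal_apply_first (hA : IsIrredTridiagonal (LinearMap.toMatrix e e A))
    (hB : ∀ i, B (e i) = t i • e i) :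
    B (A (e 0) - e.repr (A (e 0)) 0 • e 0) = t 1 • (A (e 0) - e.repr (A (e 0)) 0 • e 0) := by
  refine e.ext_elem fun i => ?_
  rw [repr_diagonal hB]
  simp only [map_sub, map_smul, Finsupp.sub_apply, Finsupp.smul_apply, Module.Basis.repr_self,
    smul_eq_mul]
  obtain rfl | h0 := eq_or_ne i 0
  · simp
  have h0' : (i : ℕ) ≠ 0 := fun h => h0 (Fin.ext h)
  by_cases h1 : (i : ℕ) = 1
  · rw [h1]
  · have hz := hA.1 i 0 (Or.inr (by simp; omega))
    rw [LinearMap.toMatrix_apply] at hz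
    simp [hz, h0.symm]

/-- The extreme vector of a tridiagonal operator `A`: its image under `A` in terms of
`[B, A]_q`. -/
lemma qComm_apply_first (hA : IsIrredTridiagonal (LinearMap.toMatrix e e A))
    (hB : ∀ i, B (e i) = t i • e i) (q : ℂ) :
    tComm q B A (e 0) = (q * t 1 - q⁻¹ * t 0) • A (e 0)
      - (e.repr (A (e 0)) 0 * (q * (t 1 - t 0))) • e 0 := by
  have h := tridiagonal_apply_first hA hB
  have h0 : B (e 0) = t 0 • e 0 := by simpa using hB 0
  rw [map_sub, map_smul, h0] at h
  simp only [tComm, LinearMap.sub_apply, LinearMap.smul_apply, Module.End.mul_apply, h0, map_smul]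
  linear_combination (norm := module) q • h

lemma qComm_apply_first' (hA : IsIrredTridiagonal (LinearMap.toMatrix e e A))
    (hB : ∀ i, B (e i) = t i • e i) (q : ℂ) :
    tComm q A B (e 0) = (q * t 0 - q⁻¹ * t 1) • A (e 0)
      + (e.repr (A (e 0)) 0 * (q⁻¹ * (t 1 - t 0))) • e 0 := by
  have h := tridiagonal_apply_first hA hB
  have h0 : B (e 0) = t 0 • e 0 := by simpa using hB 0
  rw [map_sub, map_smul, h0] at h
  simp only [tComm, LinearMap.sub_apply, LinearMap.smul_apply, Module.End.mul_apply, h0, map_smul]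
  linear_combination (norm := module) (-q⁻¹) • h

/-- Lower Hessenberg operators with nonvanishing subdiagonal. -/
def IsHessenberg (e : Module.Basis (Fin (d + 1)) ℂ V) (E : Module.End ℂ V) : Prop :=
  (∀ i j : Fin (d + 1), (j : ℕ) + 1 < i → e.repr (E (e j)) i = 0) ∧
    ∀ i j : Fin (d + 1), (j : ℕ) + 1 = i → e.repr (E (e j)) i ≠ 0

/-- Off the diagonal, `[B, A]_q` has the entries of `A` multiplied by `q t_i - q⁻¹ t_j`, so zeros
persist and `ht` protects the subdiagonal. -/
lemma isHessenberg_of_tridiagonal (hA : IsIrredTridiagonal (LinearMap.toMatrix e e A))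
    (hB : ∀ i, B (e i) = t i • e i) {q x y : ℂ} (hx : x ≠ 0)
    (ht : ∀ n, q * t (n + 1) - q⁻¹ * t n ≠ 0) :
    IsHessenberg e (x • tComm q B A + y • (1 : Module.End ℂ V)) := by
  have key : ∀ i j : Fin (d + 1), i ≠ j →
      e.repr ((x • tComm q B A + y • (1 : Module.End ℂ V)) (e j)) i
        = x * ((q * t i - q⁻¹ * t j) * LinearMap.toMatrix e e A i j) := by
    intro i j hij
    simp only [tComm, LinearMap.add_apply, LinearMap.sub_apply, LinearMap.smul_apply,
      Module.End.mul_apply, Module.End.one_apply, hB, map_add, map_sub, map_smul,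
      Finsupp.add_apply, Finsupp.sub_apply, Finsupp.smul_apply, repr_diagonal hB,
      Module.Basis.repr_self, smul_eq_mul, LinearMap.toMatrix_apply,
      Finsupp.single_eq_of_ne hij]
    ring
  refine ⟨fun i j h => ?_, fun i j h => ?_⟩
  · rw [key i j (by rintro rfl; omega), hA.1 i j (Or.inr h), mul_zero, mul_zero]
  · rw [key i j (by rintro rfl; omega)]
    refine mul_ne_zero hx (mul_ne_zero ?_ (hA.2 i j (Or.inr h)))
    rw [← h]
    exact ht j

end Diagonal

/-! ### The cyclic vector of a Hessenberg operator -/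

section Cyclic

variable {e : Module.Basis (Fin (d + 1)) ℂ V} {A E : Module.End ℂ V}

/-- Each application of `E` reaches exactly one basis vector further, with a nonzero coefficient.
This triangularity makes `e 0` a cyclic vector. -/
lemma IsHessenberg.repr_pow (hE : IsHessenberg e E) (n : ℕ) (hn : n ≤ d) :
    (∀ i : Fin (d + 1), n < i → e.repr ((E ^ n) (e 0)) i = 0) ∧
      ∀ i : Fin (d + 1), n = i → e.repr ((E ^ n) (e 0)) i ≠ 0 := by
  have expand : ∀ (v : V) (i : Fin (d + 1)),
      e.repr (E v) i = ∑ j, e.repr v j * e.repr (E (e j)) i := by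
    intro v i
    have h := congrArg (fun w => e.repr (E w) i) (e.sum_repr v)
    simp only [map_sum, map_smul, Finsupp.finsetSum_apply, Finsupp.smul_apply, smul_eq_mul] at h
    exact h.symm
  induction n with
  | zero =>
    refine ⟨fun i hi => ?_, fun i hi => ?_⟩
    · have : i ≠ 0 := fun h => by simp [h] at hi
      simp [this.symm]
    · have : i = 0 := Fin.ext hi.symm
      simp [this]
  | succ n ih =>
    obtain ⟨ih1, ih2⟩ := ih (by omega)
    refine ⟨fun i hi => ?_, fun i hi => ?_⟩
    · rw [pow_succ', Module.End.mul_apply, expand]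
      refine Finset.sum_eq_zero fun j _ => ?_
      by_cases h : n < j
      · rw [ih1 j h, zero_mul]
      · rw [hE.1 i j (by omega), mul_zero]
    · rw [pow_succ', Module.End.mul_apply, expand, Finset.sum_eq_single ⟨n, by omega⟩]
      · exact mul_ne_zero (ih2 _ rfl) (hE.2 _ _ hi)
      · intro j _ hj
        by_cases h : n < j
        · rw [ih1 j h, zero_mul]
        · have : (j : ℕ) ≠ n := fun h' => hj (Fin.ext h')
          rw [hE.1 i j (by omega), mul_zero]
      · simp

lemma IsHessenberg.eq_zero_of_aeval (hE : IsHessenberg e E) {p : ℂ[X]} (hp : p.natDegree ≤ d)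
    (h : aeval E p (e 0) = 0) : p = 0 := by
  by_contra h0
  have h1 := congrArg (fun v => e.repr v ⟨p.natDegree, by omega⟩) h
  simp only [aeval_eq_sum_range, LinearMap.sum_apply, LinearMap.smul_apply, map_sum, map_smul,
    Finsupp.finsetSum_apply, Finsupp.smul_apply, map_zero, Finsupp.zero_apply] at h1
  rw [Finset.sum_range_succ, Finset.sum_eq_zero, zero_add, smul_eq_mul] at h1
  · exact mul_ne_zero (leadingCoeff_ne_zero.mpr h0) ((hE.repr_pow _ hp).2 _ rfl) h1
  · intro i hi
    have hi' : i < p.natDegree := by simpa using hi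
    rw [(hE.repr_pow i (by omega)).1 _ hi', smul_zero]

lemma IsHessenberg.linearIndependent (hE : IsHessenberg e E) :
    LinearIndependent ℂ fun i : Fin (d + 1) => (E ^ (i : ℕ)) (e 0) := by
  rw [Fintype.linearIndependent_iff]
  intro g hg i
  have h : (∑ i : Fin (d + 1), C (g i) * X ^ (i : ℕ) : ℂ[X]) = 0 := by
    refine hE.eq_zero_of_aeval ?_ ?_
    · refine natDegree_sum_le_of_forall_le _ _ fun i _ => ?_
      exact (natDegree_C_mul_X_pow_le _ _).trans (by omega)
    · simpa [map_sum, LinearMap.sum_apply, Module.algebraMap_end_apply] using hg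
  have h2 := congrArg (fun p => coeff p (i : ℕ)) h
  simpa [finsetSum_coeff, coeff_X_pow, Fin.val_inj] using h2

/-- The basis of Krylov vectors of a Hessenberg operator. -/
noncomputable def IsHessenberg.krylov (hE : IsHessenberg e E) :
    Module.Basis (Fin (d + 1)) ℂ V :=
  basisOfLinearIndependentOfCardEqFinrank hE.linearIndependent
    (by rw [Module.finrank_eq_card_basis e])

lemma IsHessenberg.krylov_apply (hE : IsHessenberg e E) (i : Fin (d + 1)) :
    hE.krylov i = (E ^ (i : ℕ)) (e 0) := by
  simp [IsHessenberg.krylov]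

lemma IsHessenberg.krylov_repr_aeval (hE : IsHessenberg e E) {p : ℂ[X]} (hp : p.natDegree ≤ d)
    (i : Fin (d + 1)) : hE.krylov.repr (aeval E p (e 0)) i = p.coeff i := by
  have h : aeval E p (e 0) = ∑ j : Fin (d + 1), p.coeff j • hE.krylov j := by
    rw [aeval_eq_sum_range' (Nat.lt_succ_of_le hp), LinearMap.sum_apply,
      ← Fin.sum_univ_eq_sum_range (fun j => (p.coeff j • E ^ j) (e 0))]
    simp [hE.krylov_apply]
  rw [h, Module.Basis.repr_sum_self]

/-- In the Krylov basis, column `n` of `A` lists the coefficients of `T (X ^ n)`. Only the last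
column can have degree `d + 1`; reducing it modulo `χ` costs `ν d * χ.coeff d`. -/
lemma IsHessenberg.trace_eq (hE : IsHessenberg e E) {T : ℂ[X] →ₗ[ℂ] ℂ[X]} {ν κ : ℕ → ℂ}
    (hT : ∀ n, HasTop (T (X ^ n)) n (ν n) (κ n))
    (hA : ∀ p : ℂ[X], A (aeval E p (e 0)) = aeval E (T p) (e 0)) {χ : ℂ[X]} (hχ : χ.Monic)
    (hdeg : χ.natDegree = d + 1) (h0 : aeval E χ (e 0) = 0) :
    LinearMap.trace ℂ V A = ∑ i ∈ Finset.range (d + 1), κ i - ν d * χ.coeff d := by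
  have hA' : ∀ n, A ((E ^ n) (e 0)) = aeval E (T (X ^ n)) (e 0) := fun n => by
    rw [← hA, map_pow, aeval_X]
  rw [trace_eq_sum_repr hE.krylov, Fin.sum_univ_castSucc, Finset.sum_range_succ,
    ← Fin.sum_univ_eq_sum_range]
  have hr : ∀ i : Fin d, hE.krylov.repr (A (hE.krylov i.castSucc)) i.castSucc = κ i := by
    intro i
    obtain ⟨h1, -, h3⟩ := hT i
    rw [hE.krylov_apply, hA', hE.krylov_repr_aeval]
    · exact h3
    · exact h1.trans (Nat.succ_le_of_lt i.2)
  have hl : hE.krylov.repr (A (hE.krylov (Fin.last d))) (Fin.last d) = κ d - ν d * χ.coeff d := by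
    obtain ⟨h1, h2, h3⟩ := hT d
    have he : aeval E (T (X ^ d)) (e 0) = aeval E (T (X ^ d) - C (ν d) * χ) (e 0) := by
      rw [map_sub, map_mul, LinearMap.sub_apply, Module.End.mul_apply, h0, LinearMap.map_zero, sub_zero]
    rw [hE.krylov_apply, hA', Fin.val_last, he, hE.krylov_repr_aeval]
    · simp [h3]
    · have h4 : (T (X ^ d) - C (ν d) * χ).natDegree ≤ d + 1 :=
        natDegree_sub_le_same h1 ((natDegree_C_mul_le _ _).trans hdeg.le)
      have h5 : (T (X ^ d) - C (ν d) * χ).coeff (d + 1) = 0 := by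
        have : χ.coeff (d + 1) = 1 := by rw [← hdeg]; exact hχ
        rw [coeff_sub, h2, coeff_C_mul, this, mul_one, sub_self]
      by_contra hlt
      have h6 : (T (X ^ d) - C (ν d) * χ).natDegree = d + 1 := by omega
      have h7 : T (X ^ d) - C (ν d) * χ = 0 := by
        rw [← leadingCoeff_eq_zero, leadingCoeff, h6, h5]
      rw [h7] at h6
      simp at h6
  rw [hl, Finset.sum_congr rfl fun i _ => hr i]
  ring

/-- A monic polynomial of degree `d + 1` that is singular for the operator representing `A`, and
agrees with the characteristic polynomial in its second coefficient, annihilates the cyclic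
vector. -/
lemma IsHessenberg.aeval_eq_zero_of_singular (hE : IsHessenberg e E) {T : ℂ[X] →ₗ[ℂ] ℂ[X]}
    {ν : ℕ → ℂ} (hT : ∀ (p : ℂ[X]) (n : ℕ), p.natDegree ≤ n →
      (T p).natDegree ≤ n + 1 ∧ (T p).coeff (n + 1) = ν n * p.coeff n)
    (hν : ∀ n, n < d + 1 → ν n ≠ ν (d + 1))
    (hA : ∀ p : ℂ[X], A (aeval E p (e 0)) = aeval E (T p) (e 0)) {χ Φ : ℂ[X]} (hχ : χ.Monic)
    (hχd : χ.natDegree = d + 1) (h0 : aeval E χ (e 0) = 0) (hΦ : Φ.Monic)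
    (hΦd : Φ.natDegree = d + 1) (hcoeff : Φ.coeff d = χ.coeff d) {ℓ₀ : ℂ}
    (hsing : T Φ = (C (ν (d + 1)) * X + C ℓ₀) * Φ) : aeval E Φ (e 0) = 0 := by
  set D := Φ - χ with hD
  have hDΦ : aeval E Φ (e 0) = aeval E D (e 0) := by
    rw [hD, map_sub, LinearMap.sub_apply, h0, sub_zero]
  by_cases hD0 : D = 0
  · rw [hDΦ, hD0, map_zero, LinearMap.zero_apply]
  exfalso
  have hc1 : D.coeff (d + 1) = 0 := by
    have h1 : Φ.coeff (d + 1) = 1 := by rw [← hΦd]; exact hΦ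
    have h2 : χ.coeff (d + 1) = 1 := by rw [← hχd]; exact hχ
    rw [hD, coeff_sub, h1, h2, sub_self]
  have hc2 : D.coeff d = 0 := by rw [hD, coeff_sub, hcoeff, sub_self]
  have hle : D.natDegree ≤ d + 1 := natDegree_sub_le_same hΦd.le hχd.le
  have hlc : D.coeff D.natDegree ≠ 0 := leadingCoeff_ne_zero.mpr hD0
  have hlt : D.natDegree < d := by
    have n1 : D.natDegree ≠ d + 1 := fun h => hlc (h ▸ hc1)
    have n2 : D.natDegree ≠ d := fun h => hlc (h ▸ hc2)
    omega
  obtain ⟨t1, t2⟩ := hT D D.natDegree le_rfl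
  -- `D(E)` and `Φ(E)` agree on the cyclic vector, so the singularity of `Φ` passes to `D` after
  -- application to that vector. The degree is at most `d`, where annihilating the cyclic vector
  -- means being zero. The top coefficient, `ν (deg D) - ν (d + 1)` times that of `D`, then gives
  -- the contradiction.
  have hW : T D - (C (ν (d + 1)) * X + C ℓ₀) * D = 0 := by
    refine hE.eq_zero_of_aeval ((natDegree_sub_le_same (n := D.natDegree + 1) t1 ?_).trans hlt) ?_
    · have h1 : (C (ν (d + 1)) * X + C ℓ₀).natDegree ≤ 1 := natDegree_linear_le
      exact (natDegree_mul_le_of_le h1 (le_refl D.natDegree)).trans (Nat.add_comm _ _).le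
    · have m1 : ∀ p r : ℂ[X], aeval E (p * r) (e 0) = aeval E p (aeval E r (e 0)) := fun p r => by
        rw [map_mul, Module.End.mul_apply]
      have m2 : ∀ p r : ℂ[X], aeval E (p - r) (e 0) = aeval E p (e 0) - aeval E r (e 0) :=
        fun p r => by rw [map_sub, LinearMap.sub_apply]
      have m3 : aeval E (T D) (e 0) = aeval E (T Φ) (e 0) := by rw [← hA, ← hA, hDΦ]
      rw [m2, m1, m3, hsing, m1, hDΦ, sub_self]
  have h3 := congrArg (fun p => coeff p (D.natDegree + 1)) hW
  simp only [coeff_sub, t2, add_mul, coeff_add, mul_assoc, coeff_C_mul, coeff_X_mul,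
    coeff_zero] at h3
  rw [coeff_eq_zero_of_natDegree_lt (Nat.lt_succ_self _), mul_zero, add_zero, ← sub_mul] at h3
  exact (mul_ne_zero (sub_ne_zero.mpr (hν _ (by omega))) hlc) h3

end Cyclic

end Leonard


/-- The variable `w(u) = q u² + (q u²)⁻¹` of the Askey-Wilson polynomials. -/
noncomputable def wfun (q u : ℂ) : ℂ := q * u ^ 2 + (q * u ^ 2)⁻¹

/-! ### Rational identities for the coefficients of the difference operator -/

section Scalar

variable {q Q U z T x y : ℂ}

/-- The coefficient of the down shift, up to the factor `U` for `ε = +`. -/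
noncomputable def downC (q Q U z T x y : ℂ) : ℂ :=
  (q * Q)⁻¹ * (q ^ 2 * Q ^ 2 * U + U⁻¹ - q * Q * z) * (U * (y * Q⁻¹) + T + U⁻¹ * (x * Q))
    / ((U - U⁻¹) * (q * U - (q * U)⁻¹))

/-- The coefficient of the up shift, up to the factor `(q² U)⁻¹` for `ε = +`. -/
noncomputable def upC (q Q U z T x y : ℂ) : ℂ :=
  (q * Q)⁻¹ * (Q ^ 2 * (q ^ 2)⁻¹ * U⁻¹ + U - Q * q⁻¹ * z)
    * (q ^ 4 * U * (x * Q) + q ^ 2 * T + U⁻¹ * (y * Q⁻¹))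
    / ((q * U - (q * U)⁻¹) * (q ^ 2 * U - (q ^ 2 * U)⁻¹))

/-- The multiplication term. -/
noncomputable def midC (q Q U z T S : ℂ) : ℂ :=
  ((q + q⁻¹) * (S * z - (q * Q + (q * Q)⁻¹) * T)
      + (T * z - (q * Q + (q * Q)⁻¹) * S) * (q * U + (q * U)⁻¹))
    / ((U - U⁻¹) * (q ^ 2 * U - (q ^ 2 * U)⁻¹))

lemma sub_inv_eq {t : ℂ} (ht : t ≠ 0) : t - t⁻¹ = (t ^ 2 - 1) / t := by
  field_simp

lemma sq_sub_one_ne {t : ℂ} (ht : t ≠ 0) (h : t - t⁻¹ ≠ 0) : t ^ 2 - 1 ≠ 0 := by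
  intro h0
  rw [sub_inv_eq ht, h0, zero_div] at h
  exact h rfl

variable (hq : q ≠ 0) (hQ : Q ≠ 0) (hU : U ≠ 0) (h1 : U - U⁻¹ ≠ 0) (h2 : q * U - (q * U)⁻¹ ≠ 0)
  (h3 : q ^ 2 * U - (q ^ 2 * U)⁻¹ ≠ 0)

include hq hQ hU h1 h2 h3

/-- This and `plus_sum_one` are the initial conditions of `eval_polyOp` for `ε = +`: the poles of
the three coefficients cancel and a polynomial in `q U + (q U)⁻¹` remains. -/
lemma plus_sum_zero :
    U * downC q Q U z T x y + (q ^ 2 * U)⁻¹ * upC q Q U z T x y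
        + midC q Q U z T (x * Q + y * Q⁻¹)
      = y * q⁻¹ * (q * U + (q * U)⁻¹) + (Q * T - y * z * (q * Q)⁻¹) := by
  have k1 := sq_sub_one_ne hU h1
  have k2 := sq_sub_one_ne (mul_ne_zero hq hU) h2
  have k3 := sq_sub_one_ne (mul_ne_zero (pow_ne_zero 2 hq) hU) h3
  rw [mul_pow] at k2
  rw [mul_pow, ← pow_mul] at k3
  have k2' := mul_comm (q ^ 2) (U ^ 2) ▸ k2
  have k3' := mul_comm (q ^ (2 * 2)) (U ^ 2) ▸ k3
  rw [downC, upC, midC, sub_inv_eq hU, sub_inv_eq (mul_ne_zero hq hU),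
    sub_inv_eq (mul_ne_zero (pow_ne_zero 2 hq) hU)]
  field_simp
  ring

lemma plus_sum_one (hs : q + q⁻¹ ≠ 0) :
    U * downC q Q U z T x y * (q⁻¹ * U + (q⁻¹ * U)⁻¹)
        + (q ^ 2 * U)⁻¹ * upC q Q U z T x y * (q ^ 3 * U + (q ^ 3 * U)⁻¹)
        + midC q Q U z T (x * Q + y * Q⁻¹) * (q * U + (q * U)⁻¹)
      = (q ^ 2)⁻¹ * (q * U + (q * U)⁻¹)
          * (y * q⁻¹ * (q * U + (q * U)⁻¹) + (Q * T - y * z * (q * Q)⁻¹))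
        + (q ^ 2 - (q ^ 2)⁻¹) * q⁻¹ * (x + y
          + (T * z - (q * Q + (q * Q)⁻¹) * (x * Q + y * Q⁻¹)) / (q + q⁻¹)) := by
  have k1 := sq_sub_one_ne hU h1
  have k2 := sq_sub_one_ne (mul_ne_zero hq hU) h2
  have k3 := sq_sub_one_ne (mul_ne_zero (pow_ne_zero 2 hq) hU) h3
  rw [mul_pow] at k2
  rw [mul_pow, ← pow_mul] at k3
  have k2' := mul_comm (q ^ 2) (U ^ 2) ▸ k2
  have k3' := mul_comm (q ^ (2 * 2)) (U ^ 2) ▸ k3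
  have e : ∀ W : ℂ, (q ^ 2 - (q ^ 2)⁻¹) * q⁻¹ * (x + y + W / (q + q⁻¹))
      = (q ^ 2 - (q ^ 2)⁻¹) * q⁻¹ * (x + y) + (q - q⁻¹) * q⁻¹ * W := by
    intro W
    have : q ^ 2 - (q ^ 2)⁻¹ = (q - q⁻¹) * (q + q⁻¹) := by field_simp; ring
    rw [this]
    generalize q + q⁻¹ = s at hs
    field_simp
  rw [e, downC, upC, midC, sub_inv_eq hU, sub_inv_eq (mul_ne_zero hq hU),
    sub_inv_eq (mul_ne_zero (pow_ne_zero 2 hq) hU)]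
  field_simp
  ring

/-- The sum is constant because the reference state for `ε = -` is an eigenvector of `A`; the
constant is its eigenvalue `b + c`. -/
lemma minus_sum_zero :
    downC q Q U z T x y + upC q Q U z T x y + midC q Q U z (x * Q + y * Q⁻¹) T = x + y := by
  have k1 := sq_sub_one_ne hU h1
  have k2 := sq_sub_one_ne (mul_ne_zero hq hU) h2
  have k3 := sq_sub_one_ne (mul_ne_zero (pow_ne_zero 2 hq) hU) h3
  rw [mul_pow] at k2
  rw [mul_pow, ← pow_mul] at k3
  have k2' := mul_comm (q ^ 2) (U ^ 2) ▸ k2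
  have k3' := mul_comm (q ^ (2 * 2)) (U ^ 2) ▸ k3
  rw [downC, upC, midC, sub_inv_eq hU, sub_inv_eq (mul_ne_zero hq hU),
    sub_inv_eq (mul_ne_zero (pow_ne_zero 2 hq) hU)]
  field_simp
  ring

lemma minus_sum_one (hs : q + q⁻¹ ≠ 0) :
    downC q Q U z T x y * (q⁻¹ * U + (q⁻¹ * U)⁻¹)
        + upC q Q U z T x y * (q ^ 3 * U + (q ^ 3 * U)⁻¹)
        + midC q Q U z (x * Q + y * Q⁻¹) T * (q * U + (q * U)⁻¹)
      = (q ^ 2)⁻¹ * (x + y) * (q * U + (q * U)⁻¹)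
        + (q ^ 2 - (q ^ 2)⁻¹) * q⁻¹ * (q * x * (q * U + (q * U)⁻¹) + (T * Q⁻¹ - q * x * Q * z)
          + ((x * Q + y * Q⁻¹) * z - (q * Q + (q * Q)⁻¹) * T) / (q + q⁻¹)) := by
  have k1 := sq_sub_one_ne hU h1
  have k2 := sq_sub_one_ne (mul_ne_zero hq hU) h2
  have k3 := sq_sub_one_ne (mul_ne_zero (pow_ne_zero 2 hq) hU) h3
  rw [mul_pow] at k2
  rw [mul_pow, ← pow_mul] at k3
  have k2' := mul_comm (q ^ 2) (U ^ 2) ▸ k2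
  have k3' := mul_comm (q ^ (2 * 2)) (U ^ 2) ▸ k3
  have e : ∀ W W' : ℂ, (q ^ 2 - (q ^ 2)⁻¹) * q⁻¹ * (W' + W / (q + q⁻¹))
      = (q ^ 2 - (q ^ 2)⁻¹) * q⁻¹ * W' + (q - q⁻¹) * q⁻¹ * W := by
    intro W W'
    have : q ^ 2 - (q ^ 2)⁻¹ = (q - q⁻¹) * (q + q⁻¹) := by field_simp; ring
    rw [this]
    generalize q + q⁻¹ = s at hs
    field_simp
  rw [e, downC, upC, midC, sub_inv_eq hU, sub_inv_eq (mul_ne_zero hq hU),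
    sub_inv_eq (mul_ne_zero (pow_ne_zero 2 hq) hU)]
  field_simp
  ring

/-- The action of the shifts on a polynomial whose roots form a full string. -/
lemma plus_sum_string {p₀ pd pu c₀ : ℂ}
    (hd : pd * (q * Q * U + (q * Q * U)⁻¹ - z) = p₀ * ((q * Q)⁻¹ * U + q * Q * U⁻¹ - z))
    (hu : pu * (q * Q⁻¹ * U + q⁻¹ * Q * U⁻¹ - z)
      = p₀ * (q ^ 3 * Q * U + (q ^ 3 * Q * U)⁻¹ - z))
    (hc : c₀ = T * (q ^ 2 * Q)⁻¹ - y * z * (q * Q)⁻¹) :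
    U * downC q Q U z T x y * pd + (q ^ 2 * U)⁻¹ * upC q Q U z T x y * pu
        + midC q Q U z T (x * Q + y * Q⁻¹) * p₀
      = (y * q⁻¹ * (q ^ 2)⁻¹ * (Q ^ 2)⁻¹ * (q * U + (q * U)⁻¹) + c₀) * p₀ := by
  have k1 := sq_sub_one_ne hU h1
  have k2 := sq_sub_one_ne (mul_ne_zero hq hU) h2
  have k3 := sq_sub_one_ne (mul_ne_zero (pow_ne_zero 2 hq) hU) h3
  rw [mul_pow] at k2
  rw [mul_pow, ← pow_mul] at k3
  have k2' := mul_comm (q ^ 2) (U ^ 2) ▸ k2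
  have k3' := mul_comm (q ^ (2 * 2)) (U ^ 2) ▸ k3
  -- The factor of `downC` containing `z` equals `q Q U + (q Q U)⁻¹ - z`, the end factor in `hd`, so
  -- `pd` is traded for `p₀` without a division. The same happens for `upC` and `hu`.
  have ed : downC q Q U z T x y * pd = (U * (y * Q⁻¹) + T + U⁻¹ * (x * Q))
      / ((U - U⁻¹) * (q * U - (q * U)⁻¹)) * (p₀ * ((q * Q)⁻¹ * U + q * Q * U⁻¹ - z)) := by
    rw [← hd, downC]
    field_simp
  have eu : upC q Q U z T x y * pu = (q ^ 2)⁻¹ * (q ^ 4 * U * (x * Q) + q ^ 2 * T + U⁻¹ * (y * Q⁻¹))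
      / ((q * U - (q * U)⁻¹) * (q ^ 2 * U - (q ^ 2 * U)⁻¹))
      * (p₀ * (q ^ 3 * Q * U + (q ^ 3 * Q * U)⁻¹ - z)) := by
    rw [← hu, upC]
    field_simp
    ring
  rw [mul_assoc, ed, mul_assoc _ (upC _ _ _ _ _ _ _), eu, midC, hc, sub_inv_eq hU,
    sub_inv_eq (mul_ne_zero hq hU), sub_inv_eq (mul_ne_zero (pow_ne_zero 2 hq) hU)]
  field_simp
  ring

end Scalar


/-! ### Products of `bfun` as differences of values of `wfun` -/

lemma bfun_mul_bfun {q u v : ℂ} (hq : q ≠ 0) (hu : u ≠ 0) (hv : v ≠ 0) :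
    bfun (u / v) * bfun (q * u * v) = wfun q u - wfun q v := by
  simp only [bfun, wfun]
  field_simp
  ring

lemma bfun_mul_bfun_down {q u v : ℂ} (hq : q ≠ 0) (hu : u ≠ 0) (hv : v ≠ 0) :
    bfun (u / (q * v)) * bfun (u * v) = q⁻¹ * u ^ 2 + (q⁻¹ * u ^ 2)⁻¹ - wfun q v := by
  simp only [bfun, wfun]
  field_simp
  ring

lemma bfun_mul_bfun_up {q u v : ℂ} (hq : q ≠ 0) (hu : u ≠ 0) (hv : v ≠ 0) :
    bfun (q * u / v) * bfun (q ^ 2 * u * v)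
      = q ^ 3 * u ^ 2 + (q ^ 3 * u ^ 2)⁻¹ - wfun q v := by
  simp only [bfun, wfun]
  field_simp
  ring

lemma bfun_zeta {p ζ : ℂ} (hp : p ≠ 0) (hζ : ζ ≠ 0) :
    bfun (p * ζ) * bfun (p * ζ⁻¹) = p ^ 2 + (p ^ 2)⁻¹ - (ζ ^ 2 + (ζ ^ 2)⁻¹) := by
  simp only [bfun]
  field_simp
  ring

/-! ### Structure constants in terms of `θmid`, `θsMid` and `zsum` -/

namespace QRacahParams

variable (P : QRacahParams)

/-- `ζ² + ζ⁻²`, which is `r₀ θ⋄_s`. -/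
noncomputable def zsum : ℂ := P.ζ ^ 2 + (P.ζ ^ 2)⁻¹

lemma bs_mul_cs_ne_zero : P.bs * P.cs ≠ 0 := by
  rw [P.bcs_eq]
  exact inv_ne_zero (pow_ne_zero 2 P.r0_ne_zero)

lemma bs_ne_zero : P.bs ≠ 0 := left_ne_zero_of_mul P.bs_mul_cs_ne_zero

lemma cs_ne_zero : P.cs ≠ 0 := right_ne_zero_of_mul P.bs_mul_cs_ne_zero

lemma b_mul_c : P.b * P.c = P.bs * P.cs := P.bc_eq.trans P.bcs_eq.symm

lemma b_ne_zero : P.b ≠ 0 := left_ne_zero_of_mul (P.b_mul_c ▸ P.bs_mul_cs_ne_zero)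

lemma c_ne_zero : P.c ≠ 0 := right_ne_zero_of_mul (P.b_mul_c ▸ P.bs_mul_cs_ne_zero)

lemma q_pow_ne_zero (n : ℕ) : P.q ^ n ≠ 0 := pow_ne_zero n P.q_ne_zero

lemma q_sub_inv_ne_zero : P.q - P.q⁻¹ ≠ 0 := by
  simpa using pow_sub_inv_ne_zero P.q_ne_zero P.q_not_root_of_unity one_pos

lemma q_add_inv_ne_zero : P.q + P.q⁻¹ ≠ 0 := by
  simpa using pow_add_inv_ne_zero P.q_ne_zero P.q_not_root_of_unity one_pos

lemma q_sq_sub_inv_ne_zero : P.q ^ 2 - (P.q ^ 2)⁻¹ ≠ 0 :=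
  pow_sub_inv_ne_zero P.q_ne_zero P.q_not_root_of_unity two_pos

lemma q_sq_sub_inv : P.q ^ 2 - (P.q ^ 2)⁻¹ = (P.q - P.q⁻¹) * (P.q + P.q⁻¹) := by
  have := P.q_ne_zero
  field_simp
  ring

lemma zpow_d_add_one : P.q ^ ((P.d : ℤ) + 1) = P.q * P.q ^ P.d := by
  rw [zpow_add_one₀ P.q_ne_zero, zpow_natCast, mul_comm]

lemma zpow_neg_d : P.q ^ (-(P.d : ℤ)) = (P.q ^ P.d)⁻¹ := by
  rw [zpow_neg, zpow_natCast]

lemma zpow_neg_d_sub_one : P.q ^ (-(P.d : ℤ) - 1) = (P.q * P.q ^ P.d)⁻¹ := by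
  rw [← P.zpow_d_add_one, ← zpow_neg]
  congr 1
  ring

lemma zpow_d_sub_one : P.q ^ ((P.d : ℤ) - 1) = P.q ^ P.d * P.q⁻¹ := by
  rw [zpow_sub_one₀ P.q_ne_zero, zpow_natCast]

lemma θ_eq (n : ℕ) : P.θ n = P.b * (P.q ^ n) ^ 2 + P.c * ((P.q ^ n) ^ 2)⁻¹ := by
  rw [θ, neg_mul, zpow_neg, show (2 * (n : ℤ)) = ((n * 2 : ℕ) : ℤ) by push_cast; ring,
    zpow_natCast, pow_mul]

lemma θs_eq (n : ℕ) : P.θs n = P.bs * (P.q ^ n) ^ 2 + P.cs * ((P.q ^ n) ^ 2)⁻¹ := by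
  rw [θs, neg_mul, zpow_neg, show (2 * (n : ℤ)) = ((n * 2 : ℕ) : ℤ) by push_cast; ring,
    zpow_natCast, pow_mul]

lemma θmid_eq : P.θmid = P.b * P.q ^ P.d + P.c * (P.q ^ P.d)⁻¹ := by
  rw [θmid, zpow_natCast, P.zpow_neg_d]

lemma θsMid_eq : P.θsMid = P.bs * P.q ^ P.d + P.cs * (P.q ^ P.d)⁻¹ := by
  rw [θsMid, zpow_natCast, P.zpow_neg_d]

lemma θdMid_eq : P.θdMid = P.zsum / P.r0 := by
  have h1 := P.zeta_inv_sq
  have h2 := P.zeta_sq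
  have hr := P.r0_ne_zero
  rw [θdMid, zpow_natCast, P.zpow_neg_d, eq_div_iff hr, zsum, h1]
  rw [h2]
  ring

lemma ρ_eq : P.ρ = -(P.q ^ 2 - (P.q ^ 2)⁻¹) ^ 2 * (P.bs * P.cs) := by
  rw [ρ, P.bcs_eq, div_eq_mul_inv]

lemma ρ_ne_zero : P.ρ ≠ 0 := by
  rw [ρ_eq]
  exact mul_ne_zero (neg_ne_zero.mpr (pow_ne_zero 2 P.q_sq_sub_inv_ne_zero)) P.bs_mul_cs_ne_zero

/-- `q^{2s+1} + q^{-2s-1}`. -/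
noncomputable def nsum : ℂ := P.q * P.q ^ P.d + (P.q * P.q ^ P.d)⁻¹

lemma ω_eq : P.ω = -(P.q - P.q⁻¹) ^ 2
    * (P.θmid * P.θsMid - P.nsum * (P.bs * P.cs * P.zsum)) := by
  rw [ω, omegaOf, P.zpow_d_add_one, P.zpow_neg_d_sub_one, θdMid_eq, P.bcs_eq, nsum]
  have := P.r0_ne_zero
  field_simp

lemma η_eq : P.η = -(P.q - P.q⁻¹) ^ 2 * ((P.q + P.q⁻¹) * (P.bs * P.cs)
    * (P.θmid * P.zsum - P.nsum * P.θsMid)) := by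
  rw [η, omegaOf, P.zpow_d_add_one, P.zpow_neg_d_sub_one, θdMid_eq, P.bcs_eq, nsum]
  have := P.r0_ne_zero
  field_simp

lemma ηs_eq : P.ηs = -(P.q - P.q⁻¹) ^ 2 * ((P.q + P.q⁻¹) * (P.bs * P.cs)
    * (P.θsMid * P.zsum - P.nsum * P.θmid)) := by
  rw [ηs, omegaOf, P.zpow_d_add_one, P.zpow_neg_d_sub_one, θdMid_eq, P.bcs_eq, nsum]
  have := P.r0_ne_zero
  field_simp

lemma η_div_ρ : P.η / P.ρ = (P.θmid * P.zsum - P.nsum * P.θsMid) / (P.q + P.q⁻¹) := by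
  rw [η_eq, ρ_eq, P.q_sq_sub_inv]
  have h1 := P.q_sub_inv_ne_zero
  have h2 := P.q_add_inv_ne_zero
  have h3 := P.bs_mul_cs_ne_zero
  generalize P.q - P.q⁻¹ = x at *
  generalize P.q + P.q⁻¹ = y at *
  generalize P.bs * P.cs = w at *
  field_simp

lemma ηs_div_ρ : P.ηs / P.ρ = (P.θsMid * P.zsum - P.nsum * P.θmid) / (P.q + P.q⁻¹) := by
  rw [ηs_eq, ρ_eq, P.q_sq_sub_inv]
  have h1 := P.q_sub_inv_ne_zero
  have h2 := P.q_add_inv_ne_zero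
  have h3 := P.bs_mul_cs_ne_zero
  generalize P.q - P.q⁻¹ = x at *
  generalize P.q + P.q⁻¹ = y at *
  generalize P.bs * P.cs = w at *
  field_simp

/-! ### The coefficients of the off-shell action as shift coefficients -/

/-- The coefficient of the shift `u ↦ q⁻¹ u`. -/
noncomputable def downShift (ε : Eps) (u : ℂ) : ℂ :=
  match ε with
  | .plus => u ^ 2 * downC P.q (P.q ^ P.d) (u ^ 2) P.zsum P.θmid P.bs P.cs
  | .minus => downC P.q (P.q ^ P.d) (u ^ 2) P.zsum P.θsMid P.b P.c

/-- The coefficient of the shift `u ↦ q u`. -/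
noncomputable def upShift (ε : Eps) (u : ℂ) : ℂ :=
  match ε with
  | .plus => (P.q ^ 2 * u ^ 2)⁻¹ * upC P.q (P.q ^ P.d) (u ^ 2) P.zsum P.θmid P.bs P.cs
  | .minus => upC P.q (P.q ^ P.d) (u ^ 2) P.zsum P.θsMid P.b P.c

/-- The multiplication term. -/
noncomputable def noShift (u : ℂ) : ℂ :=
  midC P.q (P.q ^ P.d) (u ^ 2) P.zsum P.θmid P.θsMid

lemma noShift_eq (u : ℂ) :
    (P.q + P.q⁻¹) ^ 2 / (P.ρ * bfun (u ^ 2) * bfun (P.q ^ 2 * u ^ 2))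
        * (P.ηs + P.η * ((P.q * u ^ 2 + P.q⁻¹ * (u ^ 2)⁻¹) / (P.q + P.q⁻¹)))
      = P.noShift u := by
  have h1 := P.q_add_inv_ne_zero
  have h2 := P.ρ_ne_zero
  have e1 : P.ηs = P.ρ * ((P.θsMid * P.zsum - P.nsum * P.θmid) / (P.q + P.q⁻¹)) := by
    rw [← ηs_div_ρ, mul_div_cancel₀ _ h2]
  have e2 : P.η = P.ρ * ((P.θmid * P.zsum - P.nsum * P.θsMid) / (P.q + P.q⁻¹)) := by
    rw [← η_div_ρ, mul_div_cancel₀ _ h2]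
  rw [e1, e2, noShift, midC, ← nsum, mul_inv P.q (u ^ 2)]
  simp only [bfun]
  generalize P.q * u ^ 2 + P.q⁻¹ * (u ^ 2)⁻¹ = W
  generalize u ^ 2 - (u ^ 2)⁻¹ = x
  generalize P.q ^ 2 * u ^ 2 - (P.q ^ 2 * u ^ 2)⁻¹ = y
  generalize P.q + P.q⁻¹ = s at *
  field_simp

variable {u : ℂ} (hu : u ≠ 0)
include hu

/-- The last two factors of `Λ₁` multiply to a single factor in `u²`; by `b c = b* c*` its middle
term is `θmid` for `ε = +` and `θsMid` for `ε = -`. -/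
lemma downShift_eq (ε : Eps) :
    u ^ (2 * ε.toInt + 1) * P.Λ₁ ε u / (bfun (u ^ 2) * bfun (P.q * u ^ 2)) = P.downShift ε u := by
  have hq := P.q_ne_zero
  have hQ := P.q_pow_ne_zero P.d
  have hb := P.b_ne_zero
  have hc := P.cs_ne_zero
  have hζ := P.zeta_ne_zero
  have hbc := P.b_mul_c
  cases ε with
  | plus =>
    have e : u ^ (2 * Eps.plus.toInt + 1) * P.Λ₁ .plus u
        = u ^ 2 * ((P.q * P.q ^ P.d)⁻¹
          * (P.q ^ 2 * (P.q ^ P.d) ^ 2 * u ^ 2 + (u ^ 2)⁻¹ - P.q * P.q ^ P.d * P.zsum)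
          * (u ^ 2 * (P.cs * (P.q ^ P.d)⁻¹) + P.θmid + (u ^ 2)⁻¹ * (P.bs * P.q ^ P.d))) := by
      rw [Λ₁, P.zpow_d_add_one, P.zpow_neg_d_sub_one, P.zpow_neg_d, P.θmid_eq, zsum, zpow_natCast]
      simp only [Eps.toInt]
      norm_num
      generalize P.q ^ P.d = Q at *
      have hc' : P.c = P.bs * P.cs / P.b := by rw [← hbc]; field_simp
      rw [hc']
      field_simp
      ring
    rw [e, downShift, downC, bfun, bfun, mul_div_assoc]
  | minus =>
    have e : u ^ (2 * Eps.minus.toInt + 1) * P.Λ₁ .minus u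
        = (P.q * P.q ^ P.d)⁻¹
          * (P.q ^ 2 * (P.q ^ P.d) ^ 2 * u ^ 2 + (u ^ 2)⁻¹ - P.q * P.q ^ P.d * P.zsum)
          * (u ^ 2 * (P.c * (P.q ^ P.d)⁻¹) + P.θsMid + (u ^ 2)⁻¹ * (P.b * P.q ^ P.d)) := by
      rw [Λ₁, P.zpow_d_add_one, P.zpow_neg_d_sub_one, P.zpow_neg_d, P.θsMid_eq, zsum, zpow_natCast]
      simp only [Eps.toInt]
      norm_num
      generalize P.q ^ P.d = Q at *
      have hb' : P.bs = P.b * P.c / P.cs := by rw [hbc]; field_simp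
      rw [hb']
      field_simp
      ring
    rw [e, downShift, downC, bfun, bfun]

lemma upShift_eq (ε : Eps) (h1 : bfun (u ^ 2) ≠ 0) :
    P.q ^ (-ε.toInt - 1) * u⁻¹ * P.Λ₂ ε u / (bfun (u ^ 2) * bfun (P.q ^ 2 * u ^ 2))
      = P.upShift ε u := by
  have hq := P.q_ne_zero
  have hQ := P.q_pow_ne_zero P.d
  have hb := P.b_ne_zero
  have hc := P.cs_ne_zero
  have hζ := P.zeta_ne_zero
  have hbc := P.b_mul_c
  have hD : P.q * u ^ 2 - P.q⁻¹ * (u ^ 2)⁻¹ = P.q * u ^ 2 - (P.q * u ^ 2)⁻¹ := by rw [mul_inv]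
  cases ε with
  | plus =>
    have e : P.q ^ (-Eps.plus.toInt - 1) * u⁻¹ * P.Λ₂ .plus u
        = (P.q ^ 2 * u ^ 2)⁻¹ * ((P.q * P.q ^ P.d)⁻¹
          * ((P.q ^ P.d) ^ 2 * (P.q ^ 2)⁻¹ * (u ^ 2)⁻¹ + u ^ 2 - P.q ^ P.d * P.q⁻¹ * P.zsum)
          * (P.q ^ 4 * u ^ 2 * (P.bs * P.q ^ P.d) + P.q ^ 2 * P.θmid
            + (u ^ 2)⁻¹ * (P.cs * (P.q ^ P.d)⁻¹)))
          * ((u ^ 2 - (u ^ 2)⁻¹) / (P.q * u ^ 2 - (P.q * u ^ 2)⁻¹)) := by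
      rw [Λ₂, P.zpow_d_sub_one, P.zpow_neg_d_sub_one, P.zpow_neg_d, P.θmid_eq, zsum, zpow_natCast,
        hD]
      simp only [Eps.toInt]
      norm_num
      generalize P.q * u ^ 2 - (u ^ 2)⁻¹ * P.q⁻¹ = D
      generalize P.q ^ P.d = Q at *
      have hc' : P.c = P.bs * P.cs / P.b := by rw [← hbc]; field_simp
      rw [hc']
      field_simp
      ring
    rw [e, upShift, upC]
    simp only [bfun] at *
    generalize u ^ 2 - (u ^ 2)⁻¹ = D1 at *
    field_simp
  | minus =>
    have e : P.q ^ (-Eps.minus.toInt - 1) * u⁻¹ * P.Λ₂ .minus u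
        = (P.q * P.q ^ P.d)⁻¹
          * ((P.q ^ P.d) ^ 2 * (P.q ^ 2)⁻¹ * (u ^ 2)⁻¹ + u ^ 2 - P.q ^ P.d * P.q⁻¹ * P.zsum)
          * (P.q ^ 4 * u ^ 2 * (P.b * P.q ^ P.d) + P.q ^ 2 * P.θsMid
            + (u ^ 2)⁻¹ * (P.c * (P.q ^ P.d)⁻¹))
          * ((u ^ 2 - (u ^ 2)⁻¹) / (P.q * u ^ 2 - (P.q * u ^ 2)⁻¹)) := by
      rw [Λ₂, P.zpow_d_sub_one, P.zpow_neg_d_sub_one, P.zpow_neg_d, P.θsMid_eq, zsum, zpow_natCast,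
        hD]
      simp only [Eps.toInt]
      norm_num
      generalize P.q * u ^ 2 - (u ^ 2)⁻¹ * P.q⁻¹ = D
      generalize P.q ^ P.d = Q at *
      have hb' : P.bs = P.b * P.c / P.cs := by rw [hbc]; field_simp
      rw [hb']
      field_simp
      ring
    rw [e, upShift, upC]
    simp only [bfun] at *
    generalize u ^ 2 - (u ^ 2)⁻¹ = D1 at *
    field_simp

omit hu in
lemma Yfun_eq (ε : Eps) {n : ℕ} (hu : u ≠ 0) (h1 : bfun (u ^ 2) ≠ 0) {v : Fin n → ℂ}
    (hv : ∀ i, v i ≠ 0) :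
    P.Yfun ε u v
      = P.downShift ε u * ∏ i, (P.q⁻¹ * u ^ 2 + (P.q⁻¹ * u ^ 2)⁻¹ - wfun P.q (v i))
        + P.upShift ε u * ∏ i, (P.q ^ 3 * u ^ 2 + (P.q ^ 3 * u ^ 2)⁻¹ - wfun P.q (v i))
        - P.inhom ε u := by
  rw [Yfun, P.downShift_eq hu, P.upShift_eq hu ε h1]
  simp only [bfun_mul_bfun_down P.q_ne_zero hu (hv _), bfun_mul_bfun_up P.q_ne_zero hu (hv _)]

omit hu in
lemma g_eq {n : ℕ} (hu : u ≠ 0) {v : Fin n → ℂ} (hv : ∀ i, v i ≠ 0) :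
    P.g u v = ∏ i, (wfun P.q u - wfun P.q (v i))⁻¹ := by
  rw [g]
  simp only [bfun_mul_bfun P.q_ne_zero hu (hv _)]

end QRacahParams


/-! ### Geometric sums -/

lemma geom_sum_sq {q : ℂ} (hq : q ≠ 0) (d : ℕ) :
    (q - q⁻¹) * ∑ i ∈ Finset.range (d + 1), (q ^ i) ^ 2
      = q ^ d * (q * q ^ d - (q * q ^ d)⁻¹) := by
  induction d with
  | zero => simp
  | succ d ih =>
    rw [Finset.sum_range_succ, mul_add, ih, pow_succ]
    have := pow_ne_zero d hq
    field_simp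
    ring

lemma geom_sum_sq_inv {q : ℂ} (hq : q ≠ 0) (d : ℕ) :
    (q - q⁻¹) * ∑ i ∈ Finset.range (d + 1), ((q ^ i) ^ 2)⁻¹
      = (q ^ d)⁻¹ * (q * q ^ d - (q * q ^ d)⁻¹) := by
  induction d with
  | zero => simp
  | succ d ih =>
    rw [Finset.sum_range_succ, mul_add, ih, pow_succ]
    have := pow_ne_zero d hq
    field_simp
    ring

/-! ### Polynomial identities in the variable `w(u)` -/

lemma exists_wfun_eq {q : ℂ} (hq : q ≠ 0) (x : ℂ) : ∃ u : ℂ, u ≠ 0 ∧ wfun q u = x := by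
  -- For `v = q u²` the equation is `v² - x v + 1 = 0`, with discriminant `x² - 4`.
  obtain ⟨s, hs⟩ := IsAlgClosed.exists_pow_nat_eq (x ^ 2 - 4) two_pos
  obtain ⟨u, hu⟩ := IsAlgClosed.exists_pow_nat_eq ((x + s) / (2 * q)) two_pos
  have h0 : (x + s) * (x - s) = 4 := by linear_combination -hs
  have hxs : x + s ≠ 0 := by
    intro h
    rw [h, zero_mul] at h0
    norm_num at h0
  refine ⟨u, ?_, ?_⟩
  · rintro rfl
    have : (x + s) / (2 * q) ≠ 0 := div_ne_zero hxs (by simpa using hq)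
    exact this (by rw [← hu]; norm_num)
  · rw [wfun, hu]
    field_simp
    linear_combination -h0

/-- The excluded `u` are those with `w(u)² = 4` or `w(u)² = (q + q⁻¹)²`. Multiplying by a polynomial
that vanishes there removes the exceptions, and it cancels in a domain. -/
lemma eq_of_eval_wfun {q : ℂ} (hq : q ≠ 0) {p r : ℂ[X]}
    (h : ∀ u : ℂ, u ≠ 0 → bfun (u ^ 2) ≠ 0 → bfun (q * u ^ 2) ≠ 0 → bfun (q ^ 2 * u ^ 2) ≠ 0 →
      p.eval (wfun q u) = r.eval (wfun q u)) : p = r := by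
  have h1 : (p - r) * ((X ^ 2 - C 4) * (X ^ 2 - C ((q + q⁻¹) ^ 2))) = 0 := by
    refine Polynomial.funext fun x => ?_
    obtain ⟨u, hu, rfl⟩ := exists_wfun_eq hq x
    have e1 : wfun q u ^ 2 - 4 = bfun (q * u ^ 2) ^ 2 := by
      simp only [wfun, bfun]; field_simp; ring
    have e2 : wfun q u ^ 2 - (q + q⁻¹) ^ 2 = bfun (u ^ 2) * bfun (q ^ 2 * u ^ 2) := by
      simp only [wfun, bfun]; field_simp; ring
    simp only [eval_mul, eval_sub, eval_pow, eval_X, eval_C, eval_zero]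
    rw [e1, e2]
    by_cases k1 : bfun (u ^ 2) = 0
    · simp [k1]
    by_cases k2 : bfun (q * u ^ 2) = 0
    · simp [k2]
    by_cases k3 : bfun (q ^ 2 * u ^ 2) = 0
    · simp [k3]
    rw [h u hu k1 k2 k3, sub_self, zero_mul]
  have h2 : ∀ c : ℂ, (X ^ 2 - C c : ℂ[X]) ≠ 0 := fun c => X_pow_sub_C_ne_zero two_pos c
  have h3 := (mul_eq_zero.mp h1).resolve_right (mul_ne_zero (h2 4) (h2 _))
  exact sub_eq_zero.mp h3

lemma prod_shift (a : ℤ → ℂ) (n : ℕ) :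
    (∏ j ∈ Finset.range n, a ((j : ℤ) - 1)) * a ((n : ℤ) - 1)
      = a (-1) * ∏ j ∈ Finset.range n, a j := by
  induction n with
  | zero => simp
  | succ n ih =>
    rw [Finset.prod_range_succ, ih, Finset.prod_range_succ]
    push_cast
    rw [add_sub_cancel_right]
    ring

namespace QRacahParams

variable (P : QRacahParams)

/-! ### The operator representing `A` on polynomials -/

/-- The action of `A` on the polynomials in the third generator applied to `|Ω^ε⟩`. -/
noncomputable def actionOp (ε : Eps) : ℂ[X] →ₗ[ℂ] ℂ[X] :=
  match ε with
  | .plus =>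
    polyOp (C (P.cs * P.q⁻¹) * X + C (P.q ^ P.d * P.θmid - P.cs * P.zsum * (P.q * P.q ^ P.d)⁻¹))
      (C ((P.q ^ 2)⁻¹) * X * (C (P.cs * P.q⁻¹) * X
          + C (P.q ^ P.d * P.θmid - P.cs * P.zsum * (P.q * P.q ^ P.d)⁻¹))
        + C ((P.q ^ 2 - (P.q ^ 2)⁻¹) * P.q⁻¹ * (P.bs + P.cs + P.η / P.ρ)))
      (P.q ^ 2 + (P.q ^ 2)⁻¹) ((P.q ^ 2 - (P.q ^ 2)⁻¹) ^ 2)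
      ((P.q ^ 2 - (P.q ^ 2)⁻¹) ^ 2 * (P.ηs / P.ρ))
      ((P.q ^ 2 - (P.q ^ 2)⁻¹) * (P.q - P.q⁻¹) * (P.η / P.ρ))
  | .minus =>
    polyOp (C (P.b + P.c))
      (C ((P.q ^ 2)⁻¹ * (P.b + P.c)) * X + C ((P.q ^ 2 - (P.q ^ 2)⁻¹) * P.q⁻¹)
        * (C (P.q * P.b) * X + C (P.θsMid * (P.q ^ P.d)⁻¹ - P.q * P.b * P.q ^ P.d * P.zsum)
          + C (P.η / P.ρ)))
      (P.q ^ 2 + (P.q ^ 2)⁻¹) ((P.q ^ 2 - (P.q ^ 2)⁻¹) ^ 2)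
      ((P.q ^ 2 - (P.q ^ 2)⁻¹) ^ 2 * (P.ηs / P.ρ))
      ((P.q ^ 2 - (P.q ^ 2)⁻¹) * (P.q - P.q⁻¹) * (P.η / P.ρ))

/-- This is the condition `hH` of `eval_polyOp`. Collected on one side, `noShift` has the
coefficient `-(q - q⁻¹)² (w² - (q + q⁻¹)²)`, and `w² - (q + q⁻¹)² = b(u²) b(q² u²)` is its
denominator. -/
lemma noShift_relation {u : ℂ} (hu : u ≠ 0) (h1 : bfun (u ^ 2) ≠ 0)
    (h3 : bfun (P.q ^ 2 * u ^ 2) ≠ 0) :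
    P.noShift u * wfun P.q u ^ 2
      = (P.q ^ 2 + (P.q ^ 2)⁻¹) * wfun P.q u * (P.noShift u * wfun P.q u)
        - wfun P.q u ^ 2 * P.noShift u - (P.q ^ 2 - (P.q ^ 2)⁻¹) ^ 2 * P.noShift u
        - ((P.q ^ 2 - (P.q ^ 2)⁻¹) ^ 2 * (P.ηs / P.ρ)
          + (P.q ^ 2 - (P.q ^ 2)⁻¹) * (P.q - P.q⁻¹) * (P.η / P.ρ) * wfun P.q u) := by
  have hq := P.q_ne_zero
  have hs := P.q_add_inv_ne_zero
  have hD : wfun P.q u ^ 2 - (P.q + P.q⁻¹) ^ 2 = bfun (u ^ 2) * bfun (P.q ^ 2 * u ^ 2) := by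
    simp only [wfun, bfun]; field_simp; ring
  have hM : P.noShift u * (bfun (u ^ 2) * bfun (P.q ^ 2 * u ^ 2))
      = (P.q + P.q⁻¹) * (P.θsMid * P.zsum - P.nsum * P.θmid)
        + (P.θmid * P.zsum - P.nsum * P.θsMid) * wfun P.q u := by
    rw [noShift, midC, ← nsum]
    exact div_mul_cancel₀ _ (mul_ne_zero h1 h3)
  have ht : P.q ^ 2 + (P.q ^ 2)⁻¹ = 2 + (P.q - P.q⁻¹) ^ 2 := by field_simp; ring
  rw [← hD] at hM
  rw [η_div_ρ, ηs_div_ρ, P.q_sq_sub_inv, ht]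
  generalize P.q + P.q⁻¹ = s at *
  generalize P.q - P.q⁻¹ = t at *
  generalize P.noShift u = H at *
  generalize wfun P.q u = x at *
  field_simp
  linear_combination -t ^ 2 * hM

lemma eval_actionOp (ε : Eps) {u : ℂ} (hu : u ≠ 0) (h1 : bfun (u ^ 2) ≠ 0)
    (h2 : bfun (P.q * u ^ 2) ≠ 0) (h3 : bfun (P.q ^ 2 * u ^ 2) ≠ 0) (p : ℂ[X]) :
    (P.actionOp ε p).eval (wfun P.q u)
      = P.downShift ε u * p.eval (P.q⁻¹ * u ^ 2 + (P.q⁻¹ * u ^ 2)⁻¹)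
        + P.upShift ε u * p.eval (P.q ^ 3 * u ^ 2 + (P.q ^ 3 * u ^ 2)⁻¹)
        + P.noShift u * p.eval (wfun P.q u) := by
  have hq := P.q_ne_zero
  have hQ := P.q_pow_ne_zero P.d
  have hU : u ^ 2 ≠ 0 := pow_ne_zero 2 hu
  have hm : (P.q⁻¹ * u ^ 2 + (P.q⁻¹ * u ^ 2)⁻¹) ^ 2
      = (P.q ^ 2 + (P.q ^ 2)⁻¹) * wfun P.q u * (P.q⁻¹ * u ^ 2 + (P.q⁻¹ * u ^ 2)⁻¹)
        - wfun P.q u ^ 2 - (P.q ^ 2 - (P.q ^ 2)⁻¹) ^ 2 := by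
    rw [wfun]; field_simp; ring
  have hp : (P.q ^ 3 * u ^ 2 + (P.q ^ 3 * u ^ 2)⁻¹) ^ 2
      = (P.q ^ 2 + (P.q ^ 2)⁻¹) * wfun P.q u * (P.q ^ 3 * u ^ 2 + (P.q ^ 3 * u ^ 2)⁻¹)
        - wfun P.q u ^ 2 - (P.q ^ 2 - (P.q ^ 2)⁻¹) ^ 2 := by
    rw [wfun]; field_simp; ring
  have hH := P.noShift_relation hu h1 h3
  have s0 := P.q_add_inv_ne_zero
  cases ε with
  | plus =>
    refine eval_polyOp ?_ ?_ hm hp hH p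
    · have := plus_sum_zero (z := P.zsum) (T := P.θmid) (x := P.bs) (y := P.cs) hq hQ hU h1 h2 h3
      rw [← P.θsMid_eq] at this
      simp only [eval_add, eval_mul, eval_C, eval_X]
      exact this.symm
    · have := plus_sum_one (z := P.zsum) (T := P.θmid) (x := P.bs) (y := P.cs) hq hQ hU h1 h2 h3 s0
      rw [← P.θsMid_eq, ← nsum, ← η_div_ρ] at this
      simp only [eval_add, eval_mul, eval_C, eval_X]
      exact this.symm
  | minus =>
    refine eval_polyOp ?_ ?_ hm hp hH p
    · have := minus_sum_zero (z := P.zsum) (T := P.θsMid) (x := P.b) (y := P.c) hq hQ hU h1 h2 h3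
      rw [← P.θmid_eq] at this
      simp only [eval_C]
      exact this.symm
    · have := minus_sum_one (z := P.zsum) (T := P.θsMid) (x := P.b) (y := P.c) hq hQ hU h1 h2 h3 s0
      rw [← P.θmid_eq, ← nsum, ← η_div_ρ] at this
      simp only [eval_add, eval_mul, eval_C, eval_X]
      exact this.symm

/-! ### The characteristic polynomial of the third generator -/

/-- The eigenvalues of the third generator. -/
noncomputable def thirdEig (j : ℕ) : ℂ :=
  P.q ^ (2 * (j : ℤ) - P.d) * P.ζ ^ 2 + (P.q ^ (2 * (j : ℤ) - P.d) * P.ζ ^ 2)⁻¹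

/-- The characteristic polynomial of the third generator. -/
noncomputable def thirdChar : ℂ[X] := ∏ j ∈ Finset.range (P.d + 1), (X - C (P.thirdEig j))

lemma thirdChar_monic : P.thirdChar.Monic := monic_prod_X_sub_C _ _

lemma thirdChar_natDegree : P.thirdChar.natDegree = P.d + 1 := by
  rw [thirdChar, natDegree_prod_of_monic _ _ fun j _ => monic_X_sub_C _]
  simp

lemma sqrtq_ne_zero : P.sqrtq ≠ 0 := by
  intro h
  have := P.sqrtq_sq
  rw [h] at this
  exact P.q_ne_zero (by rw [← this]; norm_num)

lemma eval_thirdChar {u : ℂ} (hu : u ≠ 0) :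
    P.thirdChar.eval (wfun P.q u) = ∏ j ∈ Finset.range (P.d + 1),
      (bfun (P.sqrtq ^ (1 + 2 * (j : ℤ) - (P.d : ℤ)) * u * P.ζ)
        * bfun (P.sqrtq ^ (1 + 2 * (j : ℤ) - (P.d : ℤ)) * u * P.ζ⁻¹)) := by
  have hp := P.sqrtq_ne_zero
  -- Reversing the second product pairs `x = s u ζ` with `y = (q / s) u ζ⁻¹`. Then `x y = q u²` and
  -- `x / y = q^(2j - d) ζ²`, so `b(x) b(y)` is `w(u)` minus the eigenvalue of index `j`.
  rw [Finset.prod_mul_distrib, ← Finset.prod_range_reflect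
    (fun j : ℕ => bfun (P.sqrtq ^ (1 + 2 * (j : ℤ) - (P.d : ℤ)) * u * P.ζ⁻¹)),
    ← Finset.prod_mul_distrib, thirdChar, eval_prod]
  refine Finset.prod_congr rfl fun j hj => ?_
  have hj' : j ≤ P.d := Nat.lt_succ_iff.mp (Finset.mem_range.mp hj)
  have e1 : (((P.d + 1 - 1 - j : ℕ) : ℤ)) = P.d - j := by
    rw [Nat.add_sub_cancel, Nat.cast_sub hj']
  rw [e1]
  have e2 : P.sqrtq ^ (1 + 2 * ((P.d : ℤ) - j) - P.d) = P.q / P.sqrtq ^ (1 + 2 * (j : ℤ) - P.d) := by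
    rw [← P.sqrtq_sq, ← zpow_natCast, ← zpow_sub₀ hp]
    congr 1
    push_cast
    ring
  have e3 : P.q ^ (2 * (j : ℤ) - P.d) = (P.sqrtq ^ (1 + 2 * (j : ℤ) - P.d)) ^ 2 / P.q := by
    rw [← P.sqrtq_sq, ← zpow_natCast, ← zpow_natCast, ← zpow_mul, ← zpow_mul, ← zpow_sub₀ hp]
    congr 1
    push_cast
    ring
  have hs : P.sqrtq ^ (1 + 2 * (j : ℤ) - P.d) ≠ 0 := zpow_ne_zero _ hp
  have hq := P.q_ne_zero
  have hζ := P.zeta_ne_zero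
  rw [e2, eval_sub, eval_X, eval_C, thirdEig, e3]
  generalize P.sqrtq ^ (1 + 2 * (j : ℤ) - P.d) = s at *
  simp only [bfun, wfun]
  field_simp
  ring

/-- `q^{1+2j-2s} U + (q^{1+2j-2s} U)⁻¹ - (ζ² + ζ⁻²)`. -/
noncomputable def stringFactor (U : ℂ) (j : ℤ) : ℂ :=
  P.q ^ (1 + 2 * j - P.d) * U + (P.q ^ (1 + 2 * j - P.d) * U)⁻¹ - P.zsum

lemma eval_thirdChar_eq_prod {u : ℂ} (hu : u ≠ 0) :
    P.thirdChar.eval (wfun P.q u)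
      = ∏ j ∈ Finset.range (P.d + 1), P.stringFactor (u ^ 2) j := by
  rw [P.eval_thirdChar hu]
  refine Finset.prod_congr rfl fun j _ => ?_
  have hp := P.sqrtq_ne_zero
  rw [bfun_zeta (mul_ne_zero (zpow_ne_zero _ hp) hu) P.zeta_ne_zero, stringFactor, zsum, mul_pow,
    ← P.sqrtq_sq, ← zpow_natCast, ← zpow_mul, ← zpow_natCast P.sqrtq 2, ← zpow_mul]
  norm_num [mul_comm]

lemma stringFactor_shift (U : ℂ) (j : ℤ) :
    P.stringFactor (U * (P.q ^ 2)⁻¹) j = P.stringFactor U (j - 1) ∧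
    P.stringFactor (U * P.q ^ 2) j = P.stringFactor U (j + 1) := by
  have hq := P.q_ne_zero
  have e1 : P.q ^ (1 + 2 * (j - 1) - P.d) = P.q ^ (1 + 2 * j - P.d) * (P.q ^ 2)⁻¹ := by
    rw [← zpow_natCast, ← zpow_neg, ← zpow_add₀ hq]
    congr 1
    push_cast
    ring
  have e2 : P.q ^ (1 + 2 * (j + 1) - P.d) = P.q ^ (1 + 2 * j - P.d) * P.q ^ 2 := by
    rw [← zpow_natCast, ← zpow_add₀ hq]
    congr 1
    push_cast
    ring
  constructor
  · rw [stringFactor, stringFactor, e1, mul_comm U, ← mul_assoc]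
  · rw [stringFactor, stringFactor, e2, mul_comm U, ← mul_assoc]

/-- The shift of `u` moves the string of factors by one place, so only the two end factors differ.
The product form avoids dividing by an end factor that may vanish. -/
lemma eval_thirdChar_down {u : ℂ} (hu : u ≠ 0) :
    P.thirdChar.eval (P.q⁻¹ * u ^ 2 + (P.q⁻¹ * u ^ 2)⁻¹) * P.stringFactor (u ^ 2) P.d
      = P.stringFactor (u ^ 2) (-1) * P.thirdChar.eval (wfun P.q u) := by
  have hq := P.q_ne_zero
  have e : P.q⁻¹ * u ^ 2 + (P.q⁻¹ * u ^ 2)⁻¹ = wfun P.q (u * P.q⁻¹) := by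
    rw [wfun]; field_simp
  rw [e, P.eval_thirdChar_eq_prod (mul_ne_zero hu (inv_ne_zero hq)), P.eval_thirdChar_eq_prod hu,
    mul_pow, inv_pow, ← prod_shift]
  simp only [P.stringFactor_shift]
  push_cast
  rw [add_sub_cancel_right]

lemma eval_thirdChar_up {u : ℂ} (hu : u ≠ 0) :
    P.thirdChar.eval (P.q ^ 3 * u ^ 2 + (P.q ^ 3 * u ^ 2)⁻¹) * P.stringFactor (u ^ 2) 0
      = P.stringFactor (u ^ 2) (P.d + 1) * P.thirdChar.eval (wfun P.q u) := by
  have hq := P.q_ne_zero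
  have e : P.q ^ 3 * u ^ 2 + (P.q ^ 3 * u ^ 2)⁻¹ = wfun P.q (u * P.q) := by
    rw [wfun]; ring_nf
  rw [e, P.eval_thirdChar_eq_prod (mul_ne_zero hu hq), P.eval_thirdChar_eq_prod hu, mul_pow]
  have := prod_shift (fun j => P.stringFactor (u ^ 2) (j + 1)) (P.d + 1)
  simp only [P.stringFactor_shift, sub_add_cancel, neg_add_cancel] at this ⊢
  push_cast at this
  linear_combination -this

/-- The end factors left by the two shifts match factors of `downC` and `upC`, so `thirdChar` splits
off from all three terms. -/
lemma actionOp_thirdChar :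
    P.actionOp .plus P.thirdChar = (C (P.cs * P.q⁻¹ * ((P.q ^ 2)⁻¹) ^ (P.d + 1)) * X
      + C (P.θmid * (P.q ^ 2 * P.q ^ P.d)⁻¹ - P.cs * P.zsum * (P.q * P.q ^ P.d)⁻¹))
        * P.thirdChar := by
  have hq := P.q_ne_zero
  have hQ := P.q_pow_ne_zero P.d
  refine eq_of_eval_wfun hq fun u hu h1 h2 h3 => ?_
  have hU : u ^ 2 ≠ 0 := pow_ne_zero 2 hu
  have hd := P.eval_thirdChar_down hu
  have hup := P.eval_thirdChar_up hu
  have z1 : P.q ^ (1 + 2 * (P.d : ℤ) - P.d) = P.q * P.q ^ P.d := by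
    rw [← P.zpow_d_add_one]; congr 1; ring
  have z2 : P.q ^ (1 + 2 * (-1 : ℤ) - P.d) = (P.q * P.q ^ P.d)⁻¹ := by
    rw [← P.zpow_neg_d_sub_one]; congr 1; ring
  have z3 : P.q ^ (1 + 2 * (0 : ℤ) - P.d) = P.q * (P.q ^ P.d)⁻¹ := by
    rw [← P.zpow_neg_d, ← zpow_one_add₀ hq]; congr 1
  have z4 : P.q ^ (1 + 2 * ((P.d : ℤ) + 1) - P.d) = P.q ^ 3 * P.q ^ P.d := by
    rw [← zpow_natCast, ← zpow_natCast, ← zpow_add₀ hq]; congr 1; push_cast; ring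
  simp only [stringFactor, z1, z2, z3, z4] at hd hup
  have key := plus_sum_string (z := P.zsum) (T := P.θmid) (x := P.bs) (y := P.cs) hq hQ hU h1 h2 h3
    (p₀ := P.thirdChar.eval (wfun P.q u))
    (pd := P.thirdChar.eval (P.q⁻¹ * u ^ 2 + (P.q⁻¹ * u ^ 2)⁻¹))
    (pu := P.thirdChar.eval (P.q ^ 3 * u ^ 2 + (P.q ^ 3 * u ^ 2)⁻¹))
    (by
      rw [hd, mul_comm]
      congr 2
      field_simp)
    (by
      rw [mul_comm (P.thirdChar.eval (wfun P.q u)), ← hup]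
      congr 2
      field_simp) rfl
  rw [← P.θsMid_eq] at key
  rw [P.eval_actionOp .plus hu h1 h2 h3, eval_mul, eval_add, eval_mul, eval_C, eval_X, eval_C]
  refine key.trans ?_
  have hpow : ((P.q ^ 2)⁻¹) ^ (P.d + 1) = (P.q ^ 2)⁻¹ * ((P.q ^ P.d) ^ 2)⁻¹ := by
    rw [pow_succ', inv_pow, ← pow_mul, ← pow_mul, mul_comm 2]
  rw [hpow]
  simp only [wfun]
  ring

lemma thirdChar_coeff :
    (P.q - P.q⁻¹) * P.thirdChar.coeff P.d
      = -(P.zsum * (P.q * P.q ^ P.d - (P.q * P.q ^ P.d)⁻¹)) := by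
  have h : P.thirdChar.coeff P.d = -∑ j ∈ Finset.range (P.d + 1), P.thirdEig j := by
    have h1 := prod_X_sub_C_nextCoeff (s := Finset.range (P.d + 1)) (f := P.thirdEig)
    rw [← h1, ← thirdChar, nextCoeff_of_natDegree_pos (by rw [thirdChar_natDegree]; omega),
      thirdChar_natDegree, Nat.add_sub_cancel]
  have h2 : ∀ j : ℕ, P.thirdEig j = (P.q ^ P.d)⁻¹ * P.ζ ^ 2 * (P.q ^ j) ^ 2
      + P.q ^ P.d * (P.ζ ^ 2)⁻¹ * ((P.q ^ j) ^ 2)⁻¹ := by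
    intro j
    rw [thirdEig, zpow_sub₀ P.q_ne_zero, zpow_natCast,
      show (2 * (j : ℤ)) = ((j * 2 : ℕ) : ℤ) by push_cast; ring, zpow_natCast, pow_mul, mul_inv,
      inv_div]
    ring
  have g1 := geom_sum_sq P.q_ne_zero P.d
  have g2 := geom_sum_sq_inv P.q_ne_zero P.d
  have hQ := P.q_pow_ne_zero P.d
  simp only [h, h2, Finset.sum_add_distrib, ← Finset.mul_sum]
  rw [zsum]
  generalize P.q * P.q ^ P.d - (P.q * P.q ^ P.d)⁻¹ = W at *
  linear_combination -((P.q ^ P.d)⁻¹ * P.ζ ^ 2) * g1 - P.q ^ P.d * (P.ζ ^ 2)⁻¹ * g2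
    - (P.ζ ^ 2 + (P.ζ ^ 2)⁻¹) * W * mul_inv_cancel₀ hQ

end QRacahParams


lemma QRacahParams.actionOp_plus_X_pow (P : QRacahParams) (n : ℕ) :
    HasTop (P.actionOp .plus (X ^ n)) n (P.cs * P.q⁻¹ * ((P.q ^ 2)⁻¹) ^ n)
      ((P.q ^ P.d * P.θmid - P.cs * P.zsum * (P.q * P.q ^ P.d)⁻¹) * ((P.q ^ 2)⁻¹) ^ n) := by
  rw [actionOp, polyOp_X_pow]
  exact opSeq_hasTop P.q_ne_zero n

/-! ### The third generator in the representation and its annihilating polynomial -/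

namespace LeonardRep

variable {P : QRacahParams} {V : Type*} [AddCommGroup V] [Module ℂ V] (R : LeonardRep P V)

/-- The normalized third generator in the representation. -/
noncomputable def thirdEnd : Module.End ℂ V :=
  thirdGen P.q P.ρ P.ω (R.π P.genA) (R.π P.genAs)

lemma relation : tComm P.q⁻¹ (R.π P.genA) (tComm P.q (R.π P.genA) (R.π P.genAs))
    = P.ρ • R.π P.genAs + P.ω • R.π P.genA + P.η • (1 : Module.End ℂ V) := by
  have h := congrArg R.π (RingQuot.mkAlgHom_rel ℂ (AWRel.rel (q := P.q) (ρ := P.ρ) (ω := P.ω)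
    (η := P.η) (ηs := P.ηs)))
  simp only [map_tComm, map_add, map_smul, map_one] at h
  exact h

lemma relation_star : tComm P.q⁻¹ (R.π P.genAs) (tComm P.q (R.π P.genAs) (R.π P.genA))
    = P.ρ • R.π P.genA + P.ω • R.π P.genAs + P.ηs • (1 : Module.End ℂ V) := by
  have h := congrArg R.π (RingQuot.mkAlgHom_rel ℂ (AWRel.relStar (q := P.q) (ρ := P.ρ) (ω := P.ω)
    (η := P.η) (ηs := P.ηs)))
  simp only [map_tComm, map_add, map_smul, map_one] at h
  exact h

lemma qComm_A_thirdEnd : P.q • (R.π P.genA * R.thirdEnd) - P.q⁻¹ • (R.thirdEnd * R.π P.genA)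
    = (P.q ^ 2 - (P.q ^ 2)⁻¹) • (R.π P.genAs + (P.η / P.ρ) • (1 : Module.End ℂ V)) :=
  qComm_left_thirdGen P.q_ne_zero P.ρ_ne_zero R.relation

lemma cubic_relation :
    R.thirdEnd * R.thirdEnd * R.π P.genA
      - (P.q ^ 2 + (P.q ^ 2)⁻¹) • (R.thirdEnd * R.π P.genA * R.thirdEnd)
      + R.π P.genA * R.thirdEnd * R.thirdEnd + (P.q ^ 2 - (P.q ^ 2)⁻¹) ^ 2 • R.π P.genA
      + ((P.q ^ 2 - (P.q ^ 2)⁻¹) ^ 2 * (P.ηs / P.ρ)) • (1 : Module.End ℂ V)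
      + ((P.q ^ 2 - (P.q ^ 2)⁻¹) * (P.q - P.q⁻¹) * (P.η / P.ρ)) • R.thirdEnd = 0 :=
  cubic_of_qComm P.q_ne_zero R.qComm_A_thirdEnd
    (qComm_thirdGen_right P.q_ne_zero P.ρ_ne_zero R.relation_star)

lemma trace_A : (P.q - P.q⁻¹) * LinearMap.trace ℂ V (R.π P.genA)
    = P.θmid * (P.q * P.q ^ P.d - (P.q * P.q ^ P.d)⁻¹) := by
  have h : LinearMap.trace ℂ V (R.π P.genA) = ∑ i ∈ Finset.range (P.d + 1), P.θ i := by
    rw [trace_eq_sum_repr R.ket, ← Fin.sum_univ_eq_sum_range]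
    refine Finset.sum_congr rfl fun i _ => ?_
    simp [R.A_ket]
  simp only [h, P.θ_eq, Finset.sum_add_distrib, ← Finset.mul_sum]
  rw [P.θmid_eq]
  linear_combination P.b * geom_sum_sq P.q_ne_zero P.d + P.c * geom_sum_sq_inv P.q_ne_zero P.d

lemma trace_As : (P.q - P.q⁻¹) * LinearMap.trace ℂ V (R.π P.genAs)
    = P.θsMid * (P.q * P.q ^ P.d - (P.q * P.q ^ P.d)⁻¹) := by
  have h : LinearMap.trace ℂ V (R.π P.genAs) = ∑ i ∈ Finset.range (P.d + 1), P.θs i := by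
    rw [trace_eq_sum_repr R.ketStar, ← Fin.sum_univ_eq_sum_range]
    refine Finset.sum_congr rfl fun i _ => ?_
    simp [R.As_ketStar]
  simp only [h, P.θs_eq, Finset.sum_add_distrib, ← Finset.mul_sum]
  rw [P.θsMid_eq]
  linear_combination P.bs * geom_sum_sq P.q_ne_zero P.d + P.cs * geom_sum_sq_inv P.q_ne_zero P.d

lemma first_diag_A :
    R.ketStar.repr (R.π P.genA (R.ketStar 0)) 0 * (P.bs * P.q - P.cs * P.q⁻¹)
      = P.θmid * (P.bs * (P.q * P.q ^ P.d) - P.cs * (P.q * P.q ^ P.d)⁻¹)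
        + (P.q ^ P.d - (P.q ^ P.d)⁻¹) * (P.bs * P.cs * P.zsum) := by
  refine first_diag_entry P.q_ne_zero P.q_not_root_of_unity P.cs_ne_zero rfl P.θsMid_eq
    (N := P.nsum) rfl (fun i => R.ketStar.repr (R.π P.genA (R.ketStar i)) i) ?_ ?_
  · intro i t ht
    have h := diag_relation R.As_ketStar (doubleComm_expand P.q_ne_zero R.relation_star) i
    rw [← P.θs_eq] at ht
    generalize R.ketStar.repr (R.π P.genA (R.ketStar i)) i = a at h ⊢
    rw [← ht, P.ηs_eq, P.ω_eq, P.ρ_eq, P.q_sq_sub_inv] at h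
    have hq := P.q_ne_zero
    have hc : 2 - (P.q ^ 2 + (P.q ^ 2)⁻¹) = -(P.q - P.q⁻¹) ^ 2 := by field_simp; ring
    rw [hc] at h
    apply mul_left_cancel₀ (neg_ne_zero.mpr (pow_ne_zero 2 P.q_sub_inv_ne_zero))
    linear_combination h
  · rw [← trace_eq_sum_repr, R.trace_A]

lemma first_diag_As :
    R.ket.repr (R.π P.genAs (R.ket 0)) 0 * (P.b * P.q - P.c * P.q⁻¹)
      = P.θsMid * (P.b * (P.q * P.q ^ P.d) - P.c * (P.q * P.q ^ P.d)⁻¹)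
        + (P.q ^ P.d - (P.q ^ P.d)⁻¹) * (P.bs * P.cs * P.zsum) := by
  refine first_diag_entry P.q_ne_zero P.q_not_root_of_unity P.c_ne_zero rfl P.θmid_eq
    (N := P.nsum) rfl (fun i => R.ket.repr (R.π P.genAs (R.ket i)) i) ?_ ?_
  · intro i t ht
    have h := diag_relation R.A_ket (doubleComm_expand P.q_ne_zero R.relation) i
    rw [← P.θ_eq] at ht
    generalize R.ket.repr (R.π P.genAs (R.ket i)) i = a at h ⊢
    rw [← ht, P.η_eq, P.ω_eq, P.ρ_eq, P.q_sq_sub_inv] at h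
    have hq := P.q_ne_zero
    have hc : 2 - (P.q ^ 2 + (P.q ^ 2)⁻¹) = -(P.q - P.q⁻¹) ^ 2 := by field_simp; ring
    rw [hc] at h
    apply mul_left_cancel₀ (neg_ne_zero.mpr (pow_ne_zero 2 P.q_sub_inv_ne_zero))
    rw [P.b_mul_c]
    linear_combination h
  · rw [← trace_eq_sum_repr, R.trace_As]

lemma thirdEnd_apply (v : V) : R.thirdEnd v = -P.ρ⁻¹ • ((P.q ^ 2 - (P.q ^ 2)⁻¹)
    • tComm P.q (R.π P.genAs) (R.π P.genA) v + ((P.q + P.q⁻¹) * P.ω) • v) := rfl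

/-- By tridiagonality `[A*, A]_q Ω` combines `A Ω`, with the nonzero coefficient `b* q (q² - q⁻²)`,
and `Ω`. Solving for `A Ω` leaves the first diagonal entry, which `first_diag_A` eliminates. -/
lemma A_ketStar_zero : R.π P.genA (R.ketStar 0) = (P.cs * P.q⁻¹) • R.thirdEnd (R.ketStar 0)
    + (P.q ^ P.d * P.θmid - P.cs * P.zsum * (P.q * P.q ^ P.d)⁻¹) • R.ketStar 0 := by
  have hq := P.q_ne_zero
  have hQ := P.q_pow_ne_zero P.d
  have hbs := P.bs_ne_zero
  have hcs := P.cs_ne_zero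
  have hs := P.q_sub_inv_ne_zero
  have hp := P.q_add_inv_ne_zero
  have ha := R.first_diag_A
  rw [thirdEnd_apply, qComm_apply_first R.A_tridiagonal R.As_ketStar P.q]
  have t0 : P.θs 0 = P.bs + P.cs := by rw [P.θs_eq]; simp
  have t1 : P.θs 1 = P.bs * P.q ^ 2 + P.cs * (P.q ^ 2)⁻¹ := by rw [P.θs_eq]; simp
  have c1 : P.q * P.θs 1 - P.q⁻¹ * P.θs 0 = P.bs * P.q * (P.q ^ 2 - (P.q ^ 2)⁻¹) := by
    rw [t0, t1]; field_simp; ring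
  have c2 : P.q * (P.θs 1 - P.θs 0)
      = P.q * (P.q - P.q⁻¹) * (P.bs * P.q - P.cs * P.q⁻¹) := by
    rw [t0, t1]; field_simp; ring
  have e : P.q * (P.θmid * (P.bs * (P.q * P.q ^ P.d) - P.cs * (P.q * P.q ^ P.d)⁻¹)
        + (P.q ^ P.d - (P.q ^ P.d)⁻¹) * (P.bs * P.cs * P.zsum))
      + (P.θmid * P.θsMid - P.nsum * (P.bs * P.cs * P.zsum))
      = P.q * P.bs * (P.q + P.q⁻¹)
        * (P.q ^ P.d * P.θmid - P.cs * P.zsum * (P.q * P.q ^ P.d)⁻¹) := by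
    rw [P.θsMid_eq, QRacahParams.nsum]
    field_simp
    ring
  rw [← ha] at e
  generalize R.ketStar.repr (R.π P.genA (R.ketStar 0)) 0 = a at *
  generalize R.π P.genA (R.ketStar 0) = w
  rw [c1, c2, P.ρ_eq, P.ω_eq, P.q_sq_sub_inv]
  generalize P.q ^ P.d * P.θmid - P.cs * P.zsum * (P.q * P.q ^ P.d)⁻¹ = β at *
  generalize P.θmid * P.θsMid - P.nsum * (P.bs * P.cs * P.zsum) = o at *
  generalize P.bs * P.q - P.cs * P.q⁻¹ = g at *
  generalize P.q - P.q⁻¹ = s at *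
  generalize P.q + P.q⁻¹ = p at *
  match_scalars
  · field_simp
  · field_simp
    linear_combination e

lemma As_ket_zero : R.π P.genAs (R.ket 0) = (P.q * P.b) • R.thirdEnd (R.ket 0)
    + (P.θsMid * (P.q ^ P.d)⁻¹ - P.q * P.b * P.q ^ P.d * P.zsum) • R.ket 0 := by
  have hq := P.q_ne_zero
  have hQ := P.q_pow_ne_zero P.d
  have hb := P.b_ne_zero
  have hc := P.c_ne_zero
  have hs := P.q_sub_inv_ne_zero
  have hp := P.q_add_inv_ne_zero
  have ha := R.first_diag_As
  rw [thirdEnd_apply, qComm_apply_first' R.As_tridiagonal R.A_ket P.q]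
  have t0 : P.θ 0 = P.b + P.c := by rw [P.θ_eq]; simp
  have t1 : P.θ 1 = P.b * P.q ^ 2 + P.c * (P.q ^ 2)⁻¹ := by rw [P.θ_eq]; simp
  have c1 : P.q * P.θ 0 - P.q⁻¹ * P.θ 1 = P.c * P.q⁻¹ * (P.q ^ 2 - (P.q ^ 2)⁻¹) := by
    rw [t0, t1]; field_simp; ring
  have c2 : P.q⁻¹ * (P.θ 1 - P.θ 0)
      = P.q⁻¹ * (P.q - P.q⁻¹) * (P.b * P.q - P.c * P.q⁻¹) := by
    rw [t0, t1]; field_simp; ring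
  rw [← P.b_mul_c] at ha
  have e : P.q⁻¹ * (P.θsMid * (P.b * (P.q * P.q ^ P.d) - P.c * (P.q * P.q ^ P.d)⁻¹)
        + (P.q ^ P.d - (P.q ^ P.d)⁻¹) * (P.b * P.c * P.zsum))
      - (P.θmid * P.θsMid - P.nsum * (P.b * P.c * P.zsum))
      = -(P.q⁻¹ * P.c * (P.q + P.q⁻¹)
        * (P.θsMid * (P.q ^ P.d)⁻¹ - P.q * P.b * P.q ^ P.d * P.zsum)) := by
    rw [P.θmid_eq, QRacahParams.nsum]
    field_simp
    ring
  rw [← ha] at e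
  generalize R.ket.repr (R.π P.genAs (R.ket 0)) 0 = a at *
  generalize R.π P.genAs (R.ket 0) = w
  rw [c1, c2, P.ρ_eq, P.ω_eq, P.q_sq_sub_inv, ← P.b_mul_c]
  generalize P.θsMid * (P.q ^ P.d)⁻¹ - P.q * P.b * P.q ^ P.d * P.zsum = β at *
  generalize P.θmid * P.θsMid - P.nsum * (P.b * P.c * P.zsum) = o at *
  generalize P.b * P.q - P.c * P.q⁻¹ = g at *
  generalize P.q - P.q⁻¹ = s at *
  generalize P.q + P.q⁻¹ = p at *
  match_scalars
  · field_simp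
  · field_simp at e ⊢
    linear_combination -e

/-- Moving `A` past `E` costs an `A*`, whose value on the reference state is known: an eigenvalue
for `ε = +`, `As_ket_zero` for `ε = -`. -/
lemma A_thirdEnd_apply (v : V) : R.π P.genA (R.thirdEnd v)
    = (P.q ^ 2)⁻¹ • R.thirdEnd (R.π P.genA v)
      + ((P.q ^ 2 - (P.q ^ 2)⁻¹) * P.q⁻¹) • (R.π P.genAs v + (P.η / P.ρ) • v) := by
  have h := LinearMap.congr_fun R.qComm_A_thirdEnd v
  simp only [LinearMap.sub_apply, LinearMap.smul_apply, Module.End.mul_apply,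
    LinearMap.add_apply, Module.End.one_apply] at h
  have hq := P.q_ne_zero
  have h' := congrArg (fun w => P.q⁻¹ • w) h
  simp only [smul_sub, smul_smul, inv_mul_cancel₀ hq, one_smul] at h'
  rw [sub_eq_iff_eq_add] at h'
  rw [h']
  match_scalars <;> field_simp

lemma apply_aeval (ε : Eps) (p : ℂ[X]) : R.π P.genA (aeval R.thirdEnd p (R.refState ε))
    = aeval R.thirdEnd (P.actionOp ε p) (R.refState ε) := by
  cases ε with
  | plus =>
    refine apply_aeval_eq_polyOp ?_ ?_ R.cubic_relation p
    · rw [map_add, map_mul, aeval_C, aeval_X, aeval_C]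
      exact R.A_ketStar_zero
    · rw [A_thirdEnd_apply]
      have h0 : R.π P.genAs (R.refState .plus) = (P.bs + P.cs) • R.refState .plus := by
        have := R.As_ketStar 0
        rw [Fin.val_zero, P.θs_eq] at this
        simpa [refState] using this
      rw [h0, show R.π P.genA (R.refState .plus) = _ from R.A_ketStar_zero]
      simp only [map_add, map_mul, aeval_X, aeval_C, LinearMap.add_apply, Module.End.mul_apply,
        Module.algebraMap_end_apply, map_smul, refState]
      module
  | minus =>
    have h0 : R.π P.genA (R.refState .minus) = (P.b + P.c) • R.refState .minus := by
      have := R.A_ket 0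
      rw [Fin.val_zero, P.θ_eq] at this
      simpa [refState] using this
    refine apply_aeval_eq_polyOp ?_ ?_ R.cubic_relation p
    · rw [aeval_C]
      exact h0
    · rw [A_thirdEnd_apply, h0, show R.π P.genAs (R.refState .minus) = _ from R.As_ket_zero]
      simp only [map_add, map_mul, aeval_X, aeval_C, LinearMap.add_apply, Module.End.mul_apply,
        Module.algebraMap_end_apply, map_smul, refState]
      module

lemma thirdEnd_isHessenberg : IsHessenberg R.ketStar R.thirdEnd := by
  have h := isHessenberg_of_tridiagonal R.A_tridiagonal R.As_ketStar (q := P.q)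
    (x := -P.ρ⁻¹ * (P.q ^ 2 - (P.q ^ 2)⁻¹)) (y := -P.ρ⁻¹ * ((P.q + P.q⁻¹) * P.ω))
    (mul_ne_zero (neg_ne_zero.mpr (inv_ne_zero P.ρ_ne_zero)) P.q_sq_sub_inv_ne_zero) (fun n => by
      have e : P.q * P.θs (n + 1) - P.q⁻¹ * P.θs n
          = P.bs * (P.q ^ n) ^ 2 * P.q * (P.q ^ 2 - (P.q ^ 2)⁻¹) := by
        rw [P.θs_eq, P.θs_eq, pow_succ]
        have hq := P.q_ne_zero
        have hQ := P.q_pow_ne_zero n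
        field_simp
        ring
      rw [e]
      exact mul_ne_zero (mul_ne_zero (mul_ne_zero P.bs_ne_zero
        (pow_ne_zero 2 (P.q_pow_ne_zero n))) P.q_ne_zero) P.q_sq_sub_inv_ne_zero)
  rwa [mul_smul, mul_smul, ← smul_add] at h

/-- By Cayley-Hamilton the characteristic polynomial of `E` annihilates the cyclic vector. The trace
of `A`, computed from the `θ_M` and again in the Krylov basis, fixes its second coefficient, which
is that of `thirdChar`; the singularity of `thirdChar` does the rest. -/
lemma aeval_thirdChar : aeval R.thirdEnd P.thirdChar (R.ketStar 0) = 0 := by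
  have : Module.Finite ℂ V := Module.Finite.of_basis R.ketStar
  have : Module.Free ℂ V := Module.Free.of_basis R.ketStar
  have hE := R.thirdEnd_isHessenberg
  have hq := P.q_ne_zero
  have hQ := P.q_pow_ne_zero P.d
  have hχ := LinearMap.charpoly_monic R.thirdEnd
  have hχd : (LinearMap.charpoly R.thirdEnd).natDegree = P.d + 1 := by
    rw [LinearMap.charpoly_natDegree, Module.finrank_eq_card_basis R.ketStar, Fintype.card_fin]
  have hχ0 : aeval R.thirdEnd (LinearMap.charpoly R.thirdEnd) (R.ketStar 0) = 0 := by
    rw [LinearMap.aeval_self_charpoly, LinearMap.zero_apply]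
  have hcoeff : P.thirdChar.coeff P.d = (LinearMap.charpoly R.thirdEnd).coeff P.d := by
    have ht := hE.trace_eq P.actionOp_plus_X_pow (R.apply_aeval .plus) hχ hχd hχ0
    have h1 := R.trace_A
    have h2 := P.thirdChar_coeff
    have h3 := geom_sum_sq_inv hq P.d
    rw [ht, ← Finset.mul_sum] at h1
    have e : ∀ n : ℕ, ((P.q ^ 2)⁻¹) ^ n = ((P.q ^ n) ^ 2)⁻¹ := fun n => by
      rw [inv_pow, ← pow_mul, ← pow_mul, mul_comm]
    simp only [e] at h1
    apply mul_left_cancel₀ (mul_ne_zero P.q_sub_inv_ne_zero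
      (mul_ne_zero (mul_ne_zero P.cs_ne_zero (inv_ne_zero hq))
        (inv_ne_zero (pow_ne_zero 2 hQ))))
    have e2 : P.q ^ P.d * (P.q ^ P.d)⁻¹ = 1 := mul_inv_cancel₀ hQ
    generalize P.q * P.q ^ P.d - (P.q * P.q ^ P.d)⁻¹ = W at *
    generalize ∑ i ∈ Finset.range (P.d + 1), ((P.q ^ i) ^ 2)⁻¹ = S at *
    generalize P.q ^ P.d = Q at *
    linear_combination P.cs * P.q⁻¹ * (Q ^ 2)⁻¹ * h2 + h1
      - (Q * P.θmid - P.cs * P.zsum * (P.q * Q)⁻¹) * h3 - P.θmid * W * e2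
  refine hE.aeval_eq_zero_of_singular (A := R.π P.genA) (T := P.actionOp .plus)
    (ν := fun n => P.cs * P.q⁻¹ * ((P.q ^ 2)⁻¹) ^ n) (fun p n hp => polyOp_top hq hp) ?_
    (R.apply_aeval .plus) hχ hχd hχ0 P.thirdChar_monic P.thirdChar_natDegree hcoeff
    P.actionOp_thirdChar
  -- Equality would give `q^(2n) = q^(2(d + 1))` with `n < d + 1`, making `q` a root of unity.
  intro n hn h
  have h1 := mul_left_cancel₀ (mul_ne_zero P.cs_ne_zero (inv_ne_zero hq)) h
  rw [inv_pow, inv_pow, inv_inj, ← pow_mul, ← pow_mul] at h1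
  have h2 : P.q ^ (2 * (P.d + 1)) = P.q ^ (2 * n) * P.q ^ (2 * (P.d + 1 - n)) := by
    rw [← pow_add]
    congr 1
    omega
  rw [h2] at h1
  exact P.q_not_root_of_unity (2 * (P.d + 1 - n)) (by omega)
    (mul_left_cancel₀ (P.q_pow_ne_zero (2 * n)) (by rw [← h1, mul_one]))

end LeonardRep


/-! ### Bethe states and the off-shell action -/

/-- The weight of a spectral parameter in a Bethe state. -/
noncomputable def weight (ε : Eps) (u : ℂ) : ℂ := bfun (u ^ 2) / u ^ ε.toInt

namespace QRacahParams

variable (P : QRacahParams)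

/-- The polynomial in `w(u)` that gives the inhomogeneous term. -/
noncomputable def inhomPoly (ε : Eps) : ℂ[X] :=
  match ε with
  | .plus => C P.νplus * P.thirdChar
  | .minus => 0

lemma eval_inhomPoly (ε : Eps) {u : ℂ} (hu : u ≠ 0) :
    (P.inhomPoly ε).eval (wfun P.q u) = P.inhom ε u := by
  cases ε with
  | plus => rw [inhomPoly, eval_mul, eval_C, P.eval_thirdChar hu, inhom]
  | minus => rw [inhomPoly, eval_zero, inhom]

/-- For `ε = +` the constant `ν₊ = c* q⁻¹ q^(-2d)` is exactly the leading coefficient of `T p`, so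
the terms of degree `d + 1` cancel. For `ε = -` there is no such term. -/
lemma actionOp_sub_inhomPoly_natDegree (ε : Eps) {p : ℂ[X]} (hp : p.Monic)
    (hd : p.natDegree = P.d) : (P.actionOp ε p - P.inhomPoly ε).natDegree ≤ P.d := by
  cases ε with
  | plus =>
    obtain ⟨h1, h2⟩ := polyOp_top (ν := P.cs * P.q⁻¹)
      (β := P.q ^ P.d * P.θmid - P.cs * P.zsum * (P.q * P.q ^ P.d)⁻¹)
      (k := (P.q ^ 2 - (P.q ^ 2)⁻¹) ^ 2) (e₀ := (P.q ^ 2 - (P.q ^ 2)⁻¹) ^ 2 * (P.ηs / P.ρ))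
      (e₁ := (P.q ^ 2 - (P.q ^ 2)⁻¹) * (P.q - P.q⁻¹) * (P.η / P.ρ))
      (γ := (P.q ^ 2 - (P.q ^ 2)⁻¹) * P.q⁻¹ * (P.bs + P.cs + P.η / P.ρ)) P.q_ne_zero hd.le
    change (P.actionOp .plus p).natDegree ≤ P.d + 1 at h1
    change (P.actionOp .plus p).coeff (P.d + 1) = _ at h2
    have hc : (P.actionOp .plus p - P.inhomPoly .plus).coeff (P.d + 1) = 0 := by
      have e1 : P.thirdChar.coeff (P.d + 1) = 1 := by
        rw [← P.thirdChar_natDegree]; exact P.thirdChar_monic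
      have e2 : p.coeff P.d = 1 := by rw [← hd]; exact hp
      have e3 : P.νplus = P.cs * P.q⁻¹ * ((P.q ^ 2)⁻¹) ^ P.d := by
        rw [νplus, sub_eq_add_neg, zpow_add₀ P.q_ne_zero, zpow_neg, zpow_one, zpow_neg, inv_pow,
          ← pow_mul, ← zpow_natCast P.q (2 * P.d)]
        push_cast
        ring
      rw [coeff_sub, h2, inhomPoly, coeff_C_mul, e1, e2, e3, sub_self]
    have hle : (P.actionOp .plus p - P.inhomPoly .plus).natDegree ≤ P.d + 1 :=
      natDegree_sub_le_same h1 ((natDegree_C_mul_le _ _).trans P.thirdChar_natDegree.le)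
    by_contra hlt
    have h6 : (P.actionOp .plus p - P.inhomPoly .plus).natDegree = P.d + 1 := by omega
    have h7 : P.actionOp .plus p - P.inhomPoly .plus = 0 := by
      rw [← leadingCoeff_eq_zero, leadingCoeff, h6, hc]
    rw [h7] at h6
    simp at h6
  | minus =>
    rw [inhomPoly, sub_zero]
    refine polyOp_degree_le (by simp) ?_ hd.le
    compute_degree

/-- The part of the prefactor of `𝓑^ε(u, m)` that does not depend on `u`. -/
noncomputable def gaugeFactor (α χ : ℂ) (ε : Eps) (m : ℤ) : ℂ :=
  match ε with
  | .plus => -(P.q ^ m * χ / (α * P.q ^ (2 * m + 2) * bfun (P.q ^ 2)))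
  | .minus => -(P.q ^ (2 * m + 1) * χ * P.q ^ (-m - 1) / (α * (P.q ^ 2)⁻¹ * bfun (P.q ^ 2)))

end QRacahParams

namespace LeonardRep

variable {P : QRacahParams} {V : Type*} [AddCommGroup V] [Module ℂ V] (R : LeonardRep P V)

/-- At `β = 0` only `[A*, A]_q` and a scalar survive; the `ω` part of the scalar is the one in `E`,
and the rest is proportional to `w(u)`. -/
lemma map_dynB (α : ℂ) {χ : ℂ} (hχ : χ ≠ 0) (ε : Eps) {u : ℂ} (hu : u ≠ 0) (m : ℤ) :
    R.π (P.dynB α 0 χ ε u m) = (P.gaugeFactor α χ ε m * weight ε u)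
      • (R.thirdEnd - wfun P.q u • (1 : Module.End ℂ V)) := by
  have hq := P.q_ne_zero
  have hρ := P.ρ_ne_zero
  have hr : P.q ^ m ≠ 0 := zpow_ne_zero _ hq
  have hb : bfun (P.q ^ 2) ≠ 0 := P.q_sq_sub_inv_ne_zero
  have hb' : P.q ^ 2 - (P.q ^ 2)⁻¹ = bfun (P.q ^ 2) := rfl
  have e1 : P.q ^ (2 * m + 2) = (P.q ^ m) ^ 2 * P.q ^ 2 := by
    rw [zpow_add₀ hq, mul_comm 2 m, zpow_mul]; norm_cast
  have e2 : P.q ^ (2 * m) = (P.q ^ m) ^ 2 := by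
    rw [mul_comm 2 m, zpow_mul]; norm_cast
  have e3 : P.q ^ (2 * m + 1) = (P.q ^ m) ^ 2 * P.q := by
    rw [zpow_add₀ hq, e2, zpow_one]
  have e4 : P.q ^ (-m - 3) = (P.q ^ m)⁻¹ * (P.q ^ 3)⁻¹ := by
    rw [zpow_sub₀ hq, zpow_neg, div_eq_mul_inv]; norm_cast
  have e5 : P.q ^ (-m - 4) = (P.q ^ m)⁻¹ * (P.q ^ 4)⁻¹ := by
    rw [zpow_sub₀ hq, zpow_neg, div_eq_mul_inv]; norm_cast
  have e6 : P.q ^ (-m - 1) = (P.q ^ m)⁻¹ * P.q⁻¹ := by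
    rw [zpow_sub₀ hq, zpow_neg, div_eq_mul_inv, zpow_one]
  cases ε with
  | plus =>
    simp only [QRacahParams.dynB, QRacahParams.gaugeFactor, weight, e1, e2, e4,
      map_smul, map_add, map_sub, map_one, map_tComm, thirdEnd, thirdGen, hb', Eps.toInt, wfun, zpow_one]
    generalize R.π P.genA = A
    generalize R.π P.genAs = As
    generalize tComm P.q As A = K
    generalize tComm P.q A As = K'
    generalize bfun (P.q ^ 2) = B at *
    generalize bfun (u ^ 2) = b₀
    generalize P.q ^ m = r at *
    simp only [div_eq_mul_inv, mul_inv, zero_mul, sub_zero]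
    generalize α⁻¹ = a
    match_scalars <;> field_simp <;> ring
  | minus =>
    simp only [QRacahParams.dynB, QRacahParams.gaugeFactor, weight, e2, e3, e5, e6,
      map_smul, map_add, map_sub, map_one, map_tComm, thirdEnd, thirdGen, hb', Eps.toInt, wfun, zpow_neg, zpow_one]
    generalize R.π P.genA = A
    generalize R.π P.genAs = As
    generalize tComm P.q As A = K
    generalize tComm P.q A As = K'
    generalize bfun (P.q ^ 2) = B at *
    generalize bfun (u ^ 2) = b₀
    generalize P.q ^ m = r at *
    simp only [div_eq_mul_inv, mul_inv, zero_mul, sub_zero]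
    generalize α⁻¹ = a
    match_scalars <;> field_simp <;> ring

/-- The gauge product does not involve `u`, so it is common to all states in the off-shell action;
only the weights distinguish them. -/
lemma betheState_eq (α : ℂ) {χ : ℂ} (hχ : χ ≠ 0) (ε : Eps) {M : ℕ} {u : Fin M → ℂ}
    (hu : ∀ i, u i ≠ 0) (m : ℤ) :
    R.betheState α χ ε u m
      = ((∏ i : Fin M, P.gaugeFactor α χ ε (m + 2 * ((M : ℤ) - 1 - (i : ℤ))))
          * ∏ i, weight ε (u i))
        • aeval R.thirdEnd (∏ i, (Polynomial.X - C (wfun P.q (u i)))) (R.refState ε) := by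
  have h : R.π (P.stringB α 0 χ ε u m) = aeval R.thirdEnd
      (∏ i : Fin M, (C (P.gaugeFactor α χ ε (m + 2 * ((M : ℤ) - 1 - (i : ℤ)))
        * weight ε (u i)) * (Polynomial.X - C (wfun P.q (u i))))) := by
    rw [QRacahParams.stringB, ← List.prod_ofFn, map_list_prod, map_list_prod, List.map_ofFn,
      List.map_ofFn]
    congr 2
    funext i
    simp only [Function.comp_apply]
    rw [R.map_dynB α hχ ε (hu i), map_mul, aeval_C, map_sub, aeval_X, aeval_C,
      Algebra.algebraMap_eq_smul_one, Algebra.algebraMap_eq_smul_one, smul_mul_assoc, one_mul]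
  rw [betheState, h, Finset.prod_mul_distrib, ← map_prod C, Finset.prod_mul_distrib, map_mul,
    aeval_C, Module.End.mul_apply, Module.algebraMap_end_apply]

lemma offShell_action (ε : Eps) (y : Fin (P.d + 1) → ℂ) (hy : P.Regular y)
    (j : Fin (P.d + 1)) :
    R.π P.genA (aeval R.thirdEnd (∏ i, (Polynomial.X - C (wfun P.q (P.removeAt y j i)))) (R.refState ε))
      = ∑ k, (P.g (y k) (P.removeAt y k) * P.Yfun ε (y k) (P.removeAt y j)
          + if j = k then P.noShift (y j) else 0)
        • aeval R.thirdEnd (∏ i, (Polynomial.X - C (wfun P.q (P.removeAt y k i)))) (R.refState ε) := by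
  have hq := P.q_ne_zero
  have hw : Function.Injective fun k => wfun P.q (y k) := by
    intro a b hab
    by_contra hne
    obtain ⟨h1, h2⟩ := hy.2 a b hne
    apply mul_ne_zero h1 h2
    rw [bfun_mul_bfun hq (hy.1 a).1 (hy.1 b).1, sub_eq_zero]
    exact hab
  set p : ℂ[X] := ∏ i, (Polynomial.X - C (wfun P.q (P.removeAt y j i))) with hp
  have hpm : p.Monic := monic_prod_X_sub_C _ _
  have hpd : p.natDegree = P.d := by
    rw [hp, natDegree_prod_of_monic _ _ fun j _ => monic_X_sub_C _]
    simp
  have hpe : ∀ x, p.eval x = ∏ i, (x - wfun P.q (P.removeAt y j i)) := fun x => by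
    simp [hp, eval_prod]
  have hinh : aeval R.thirdEnd (P.inhomPoly ε) (R.refState ε) = 0 := by
    cases ε with
    | plus =>
      rw [QRacahParams.inhomPoly, map_mul, Module.End.mul_apply]
      exact (congrArg _ R.aeval_thirdChar).trans (LinearMap.map_zero _)
    | minus => rw [QRacahParams.inhomPoly, map_zero, LinearMap.zero_apply]
  have hA : R.π P.genA (aeval R.thirdEnd p (R.refState ε))
      = aeval R.thirdEnd (P.actionOp ε p - P.inhomPoly ε) (R.refState ε) := by
    rw [map_sub, LinearMap.sub_apply, hinh, sub_zero, R.apply_aeval]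
  rw [hA, eq_sum_interpolation hw (P.actionOp_sub_inhomPoly_natDegree ε hpm hpd), map_sum,
    LinearMap.sum_apply]
  refine Finset.sum_congr rfl fun k _ => ?_
  rw [map_mul, aeval_C, Module.End.mul_apply, Module.algebraMap_end_apply]
  obtain ⟨k0, k1, k2, k3⟩ := hy.1 k
  have hg : P.g (y k) (P.removeAt y k)
      = ∏ i, (wfun P.q (y k) - wfun P.q (y (k.succAbove i)))⁻¹ :=
    P.g_eq k0 fun i => (hy.1 _).1
  have hY := P.Yfun_eq ε k0 k1 (v := P.removeAt y j) fun i => (hy.1 _).1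
  rw [eval_sub, P.eval_actionOp ε k0 k1 k2 k3, P.eval_inhomPoly ε k0, ← hg, hpe, hpe, hY]
  congr 1
  -- The roots of `p` are the nodes other than `w(y_j)`, so the multiplication term contributes to
  -- the diagonal coefficient only.
  have hlast : p.eval (wfun P.q (y k)) * P.g (y k) (P.removeAt y k) = if j = k then 1 else 0 := by
    rw [hpe, hg]
    split_ifs with h
    · subst h
      rw [← Finset.prod_mul_distrib]
      refine Finset.prod_eq_one fun i _ => mul_inv_cancel₀ (sub_ne_zero.mpr fun h => ?_)
      exact (Fin.succAbove_ne j i) (hw h).symm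
    · obtain ⟨i, hi⟩ := Fin.exists_succAbove_eq (Ne.symm h)
      rw [Finset.prod_eq_zero (Finset.mem_univ i), zero_mul]
      rw [QRacahParams.removeAt, hi, sub_self]
  have hlast' : P.noShift (y k) * p.eval (wfun P.q (y k)) * P.g (y k) (P.removeAt y k)
      = if j = k then P.noShift (y j) else 0 := by
    rw [mul_assoc, hlast]
    split_ifs with h
    · rw [h, mul_one]
    · rw [mul_zero]
  rw [← hlast']
  ring

lemma offShell_betheState (ε : Eps) (m : ℤ) (α : ℂ) {χ : ℂ} (hχ : χ ≠ 0)
    (y : Fin (P.d + 1) → ℂ) (hy : P.Regular y) (j : Fin (P.d + 1)) :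
    R.π P.genA (R.betheState α χ ε (P.removeAt y j) m)
      = ∑ k, P.Lcoef ε y j k • R.betheState α χ ε (P.removeAt y k) m := by
  have hne : ∀ k i, P.removeAt y k i ≠ 0 := fun k i => (hy.1 _).1
  simp only [fun k => R.betheState_eq α hχ ε (hne k) m]
  rw [map_smul, R.offShell_action ε y hy j, Finset.smul_sum]
  refine Finset.sum_congr rfl fun k _ => ?_
  rw [smul_smul, smul_smul]
  congr 1
  have hz : ∀ i, y i ^ ε.toInt ≠ 0 := fun i => zpow_ne_zero _ (hy.1 i).1
  have hwt : ∀ i, weight ε (y i) ≠ 0 := fun i => div_ne_zero (hy.1 i).2.1 (hz i)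
  -- Both sides are the product of the weights of all `d + 1` parameters. Hence the prefactor of
  -- `L_{jk}` is the quotient of the weights of `y_k` and `y_j`.
  have hprod : (∏ i, weight ε (P.removeAt y j i)) * weight ε (y j)
      = (∏ i, weight ε (P.removeAt y k i)) * weight ε (y k) := by
    have h := fun l : Fin (P.d + 1) =>
      Fin.prod_univ_succAbove (fun i => weight ε (y i)) l
    rw [mul_comm, mul_comm _ (weight ε (y k))]
    exact (h j).symm.trans (h k)
  have hratio : (y j / y k) ^ ε.toInt * (bfun (y k ^ 2) / bfun (y j ^ 2))
      = weight ε (y k) / weight ε (y j) := by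
    have h1 := hz j
    have h2 := hz k
    have h3 := (hy.1 j).2.1
    rw [div_zpow, weight, weight]
    field_simp
  have hS : ∏ i, weight ε (P.removeAt y j i)
      = weight ε (y k) / weight ε (y j) * ∏ i, weight ε (P.removeAt y k i) := by
    have := hwt j
    field_simp
    linear_combination hprod
  rw [QRacahParams.Lcoef, hratio, P.noShift_eq]
  split_ifs with h
  · subst h
    rw [div_self (hwt j)]
    ring
  · rw [hS]
    ring

/-- As the `θ_N` are distinct, the covector kills every other eigenvector; killing `|θ_M⟩` too would
make it zero. -/
lemma IsBra.ket_ne_zero {M : Fin (P.d + 1)} {bra : Module.Dual ℂ V} (h : R.IsBra M bra) :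
    bra (R.ket M) ≠ 0 := by
  intro h0
  refine h.1 (R.ket.ext fun N => ?_)
  rw [LinearMap.zero_apply]
  by_cases hN : N = M
  · rw [hN, h0]
  have h1 := LinearMap.congr_fun h.2 (R.ket N)
  rw [LinearMap.comp_apply, R.A_ket, map_smul, LinearMap.smul_apply, smul_eq_mul, smul_eq_mul,
    ← sub_eq_zero, ← sub_mul] at h1
  exact (mul_eq_zero.mp h1).resolve_left (sub_ne_zero.mpr fun h' => hN (R.θ_injective h'))

end LeonardRep

end LeonardBethe

theorem mainTheorem3 (P : LeonardBethe.QRacahParams)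
    {V : Type*} [AddCommGroup V] [Module ℂ V] (R : LeonardBethe.LeonardRep P V)
    (ε : LeonardBethe.Eps) (m : ℤ) (α χ : ℂ) (hχ : χ ≠ 0)
    (hα : P.GaugeCondition α χ ε m)
    (y : Fin (P.d + 1) → ℂ) (hy : P.Regular y) :
    (∀ j, R.π P.genA (R.betheState α χ ε (P.removeAt y j) m)
        = ∑ k, P.Lcoef ε y j k • R.betheState α χ ε (P.removeAt y k) m) ∧
    ∀ (M : Fin (P.d + 1)) (bra : Module.Dual ℂ V), R.IsBra M bra →
      bra (R.ket M) ≠ 0 ∧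
      ∀ j, ∑ k, P.Mmat ε M y j k * R.X α χ ε m M bra (P.removeAt y k) = 0 := by
  have hoff := R.offShell_betheState ε m α hχ y hy
  refine ⟨hoff, fun M bra hbra => ⟨hbra.ket_ne_zero, fun j => ?_⟩⟩
  -- `⟨θ_M| A` on a Bethe state is computed twice: to the left by the eigenvalue, to the right by
  -- the off-shell action.
  have h1 := LinearMap.congr_fun hbra.2 (R.betheState α χ ε (P.removeAt y j) m)
  rw [LinearMap.comp_apply, hoff j, map_sum, LinearMap.smul_apply, smul_eq_mul] at h1
  simp only [map_smul, smul_eq_mul] at h1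
  simp only [LeonardBethe.QRacahParams.Mmat, Matrix.of_apply, LeonardBethe.LeonardRep.X, sub_mul,
    Finset.sum_sub_distrib, ite_mul, zero_mul, Finset.sum_ite_eq, Finset.mem_univ, if_true]
  rw [sub_eq_zero, ← mul_div_assoc, ← h1, Finset.sum_div]
  exact Finset.sum_congr rfl fun k _ => (mul_div_assoc _ _ _).symm
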